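/- **Theorem.** Let $N\ge 1$, $0<s<1$, $1_s^*=\frac{N}{N-s}$. For $u:\mathbb R^N\to\mathbb R$ put $$[u]=\int_{\mathbb R^N}\int_{\mathbb R^N}\frac{|u(x)-u(y)|}{|x-y|^{N+s}}\,dx\,dy .$$ Let $W^{s,1}(\mathbb R^N)$ be the completion of $C_0^\infty(\mathbb R^N)$ for the norm $[u]+\|u\|_{L^1(\mathbb R^N)}$, and $D^{s,1}(\mathbb R^N)$ its completion for $[u]$ (realized as spaces of functions in $L^1(\mathbb R^N)$ and in $L^{1_s^*}(\mathbb R^N)$, respectively). For an open set $\Omega\subset\mathbb R^N$ let $W^{s,1}_0(\Omega)=\{u\in W^{s,1}(\mathbb R^N): u=0 \text{ a.e. in } \mathbb R^N\setminus\Omega\}$. Define the fractional isoperimetric constant $$\mathcal S_{s,1_s^*}=\inf_{u\in D^{s,1}(\mathbb R^N)\setminus\{0\}}\frac{[u]}{\|u\|_{L^{1_s^*}(\mathbb R^N)}}$$ and the Sobolev constants $$S_{s,q}(\Omega)=\inf_{u\in W^{s,1}_0(\Omega)\setminus\{0\}}\frac{[u]}{\|u\|_{L^q(\Omega)}},\qquad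 S_{s,q}(\mathbb R^N)=\inf_{u\in W^{s,1}(\mathbb R^N)\setminus\{0\}}\frac{[u]+\|u\|_{L^1(\mathbb R^N)}}{\|u\|_{L^q(\mathbb R^N)}} .$$ Then the following hold. (1) If $1\le q<1_s^*$ and $\Omega\subset\mathbb R^N$ is a nonempty bounded open set (in particular, a bounded smooth domain), with $R_\Omega=\sup\{R: B_R(x)\subset\Omega \text{ for some } x\in\Omega\}$, then $$\mathcal S_{s,1_s^*}\,|\Omega|^{\frac1{1_s^*}-\frac1q}\le S_{s,q}(\Omega)\le \mathcal S_{s,1_s^*}\,|B_{R_\Omega}|^{\frac1{1_s^*}-\frac1q},$$ where $B_{R_\Omega}$ is a ball of radius $R_\Omega$. (2) $S_{s,1}(\mathbb R^N)=1$. (3) If $1<q<1_s^*$, then $$\left[\tfrac Ns\left(\tfrac1q-\tfrac1{1_s^*}\right)\right]^{\frac Ns\left(\frac1{1_s^*}-\frac1q\right)}\left[\tfrac Ns\left(1-\tfrac1q\right)\right]^{\frac Ns\left(\frac1q-1\right)}\mathcal S_{s,1_s^*}^{\frac Ns\left(1-\frac1q\right)}\le S_{s,q}(\mathbb R^N)$$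 and $$S_{s,q}(\mathbb R^N)\le\tfrac sN\left(\tfrac1q-\tfrac1{1_s^*}\right)^{\frac Ns\left(\frac1{1_s^*}-\frac1q\right)}\left(1-\tfrac1q\right)^{\frac Ns\left(\frac1q-1\right)}\mathcal S_{s,1_s^*}^{\frac Ns\left(1-\frac1q\right)} .$$ -/

import Mathlib

open MeasureTheory Filter Topology
open scoped ENNReal ContDiff

namespace FracSobolev

noncomputable section

/-- The Euclidean space `ℝ^N`. -/
abbrev E (N : ℕ) : Type := EuclideanSpace ℝ (Fin N)

/-- The Gagliardo seminorm `[u]_{W^{s,1}(ℝ^N)}`, with values in `[0, ∞]`: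
the double integral of `|u(x) - u(y)| / |x - y|^{N+s}`. -/
def gagliardo {N : ℕ} (s : ℝ) (u : E N → ℝ) : ℝ≥0∞ :=
  ∫⁻ x : E N, ∫⁻ y : E N, ENNReal.ofReal (|u x - u y| / ‖x - y‖ ^ ((N : ℝ) + s))

/-- Real-valued test functions, the class `C_0^∞(ℝ^N)`. -/
def IsTest {N : ℕ} (φ : E N → ℝ) : Prop :=
  ContDiff ℝ ∞ φ ∧ HasCompactSupport φ

/-- The space `W^{s,1}(ℝ^N)`: the completion of the test functions with respect to the norm
`[u]_{W^{s,1}} + ‖u‖_{L^1}`, realized inside `L^1(ℝ^N)` as the set of limits of test functions.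
Functions are representatives; equality is almost everywhere. -/
def W (N : ℕ) (s : ℝ) : Set (E N → ℝ) :=
  {u | MemLp u 1 volume ∧ ∃ φ : ℕ → E N → ℝ, (∀ n, IsTest (φ n)) ∧
    Tendsto (fun n => gagliardo s (φ n - u) + eLpNorm (φ n - u) 1 volume) atTop (𝓝 0)}

/-- `W_0^{s,1}(Ω)`: the members of `W^{s,1}(ℝ^N)` that vanish (a.e.) outside `Ω`. -/
def W₀ {N : ℕ} (s : ℝ) (Ω : Set (E N)) : Set (E N → ℝ) :=
  {u | u ∈ W N s ∧ ∀ᵐ x ∂(volume : Measure (E N)), x ∉ Ω → u x = 0}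

/-- The critical exponent `1_s^* = N / (N - s)`. -/
def critExp (N : ℕ) (s : ℝ) : ℝ := (N : ℝ) / ((N : ℝ) - s)

/-- The homogeneous space `D^{s,1}(ℝ^N)`: the completion of the test functions with respect to
the Gagliardo seminorm, realized inside `L^{1_s^*}(ℝ^N)` as the set of limits of test functions. -/
def D (N : ℕ) (s : ℝ) : Set (E N → ℝ) :=
  {u | MemLp u (ENNReal.ofReal (critExp N s)) volume ∧ ∃ φ : ℕ → E N → ℝ, (∀ n, IsTest (φ n)) ∧
    Tendsto (fun n => gagliardo s (φ n - u)) atTop (𝓝 0)}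

/-- The fractional isoperimetric constant: the infimum of `[u]_{W^{s,1}} / ‖u‖_{L^{1_s^*}}`
over `D^{s,1}(ℝ^N) \ {0}`. -/
def isoConst (N : ℕ) (s : ℝ) : ℝ≥0∞ :=
  ⨅ (u : E N → ℝ) (_ : u ∈ D N s) (_ : ¬ u =ᵐ[volume] 0),
    gagliardo s u / eLpNorm u (ENNReal.ofReal (critExp N s)) volume

/-- `S_{s,q}(Ω)`: the infimum of `[u]_{W^{s,1}(ℝ^N)} / ‖u‖_{L^q(Ω)}` over `W_0^{s,1}(Ω) \ {0}`. -/
def sobolevConst {N : ℕ} (s q : ℝ) (Ω : Set (E N)) : ℝ≥0∞ :=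
  ⨅ (u : E N → ℝ) (_ : u ∈ W₀ s Ω) (_ : ¬ u =ᵐ[volume] 0),
    gagliardo s u / eLpNorm u (ENNReal.ofReal q) (volume.restrict Ω)

/-- `S_{s,q}(ℝ^N)`: the infimum of `([u]_{W^{s,1}(ℝ^N)} + ‖u‖_{L^1(ℝ^N)}) / ‖u‖_{L^q(ℝ^N)}`
over `W^{s,1}(ℝ^N) \ {0}`. -/
def sobolevConstWhole (N : ℕ) (s q : ℝ) : ℝ≥0∞ :=
  ⨅ (u : E N → ℝ) (_ : u ∈ W N s) (_ : ¬ u =ᵐ[volume] 0),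
    (gagliardo s u + eLpNorm u 1 volume) / eLpNorm u (ENNReal.ofReal q) volume

/-- `R_Ω`, the supremum of the radii of the balls contained in `Ω`. -/
def largestRadius {N : ℕ} (Ω : Set (E N)) : ℝ :=
  sSup {R : ℝ | ∃ x ∈ Ω, Metric.ball x R ⊆ Ω}

end

end FracSobolev

/-! Everything rests on one sharp inequality: the critical Lebesgue norm of `u` times `ballConst`,
the isoperimetric ratio of the unit ball, is at most the Gagliardo seminorm of `u`
(`ballConst_mul_eLpNorm_le`). Indicators of balls give equality and lie in both completions
(`ind_ball_mem_W`, `ind_ball_mem_D`), so the isoperimetric constant equals `ballConst`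
(`isoConst_eq_ballConst`).

The inequality for sets says that balls minimize the fractional perimeter (`gagliardo_ball_le`). For
an integrable kernel the perimeter of `A` is a multiple of the volume of `A` minus the
self-interaction of `A`, so the ball has to maximize a Riesz energy at fixed mass
(`rieszEnergy_le_ball`). Polarization does not decrease the energy. A small multiple of a strictly
radially decreasing moment is added, a maximizer exists by weak compactness, and the moment forces
it to be polarized for every reflection. Its potential is then radially nonincreasing, and the
bathtub principle, used twice, compares it with the ball. The perturbation is sent to zero. The
singular kernel is the increasing limit of bounded integrable ones.

The passage to functions is a layer cake argument: the superlevel sets of `|u|` have total perimeter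
at most the seminorm, and Minkowski's integral inequality bounds the critical norm by the integral
of the corresponding powers of their volumes.

For bounded domains the lower bound is Hölder and the upper bound tests with balls inside the
domain. On the whole space the lower bound combines interpolation between `L¹` and the critical
space with the weighted arithmetic-geometric mean inequality, and the upper bound tests with a ball
of optimal volume. The two constants displayed in the last part are the same number, so the bounds
determine the Sobolev constant exactly. For exponent one, the indicators of balls of growing volume
bring the quotient down to 1. -/

namespace FracSobolev

noncomputable section

/-! ### Reflections and polarization -/

/-- The reflection across the hyperplane `⟪v, x⟫ = c`, for a unit vector `v`. -/
def hyperRefl {N : ℕ} (v : E N) (c : ℝ) (x : E N) : E N := x - (2 * (inner ℝ v x - c)) • v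

section Reflection

variable {N : ℕ} {v : E N} {c : ℝ}

theorem inner_hyperRefl (hv : ‖v‖ = 1) (x : E N) :
    inner ℝ v (hyperRefl v c x) - c = -(inner ℝ v x - c) := by
  rw [hyperRefl, inner_sub_right, inner_smul_right, real_inner_self_eq_norm_sq, hv]
  ring

theorem hyperRefl_involutive (hv : ‖v‖ = 1) : Function.Involutive (hyperRefl v c) := by
  intro x
  have h := inner_hyperRefl (c := c) hv x
  rw [hyperRefl, h, hyperRefl, sub_sub, ← add_smul]
  ring_nf
  simp

theorem hyperRefl_eq_reflection (hv : ‖v‖ = 1) (x : E N) :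
    hyperRefl v c x = (ℝ ∙ v)ᗮ.reflection x + (2 * c) • v := by
  rw [Submodule.reflection_orthogonal_apply, Submodule.reflection_singleton_apply, hyperRefl, hv]
  simp only [RCLike.ofReal_real_eq_id, id_eq, one_pow, div_one]
  module

theorem measurePreserving_hyperRefl (hv : ‖v‖ = 1) :
    MeasurePreserving (hyperRefl v c) volume volume := by
  have h1 := (Submodule.reflection (ℝ ∙ v)ᗮ).measurePreserving
  have h2 := measurePreserving_add_right (volume : Measure (E N)) ((2 * c) • v)
  have h3 := h2.comp h1
  exact (funext (hyperRefl_eq_reflection hv) : hyperRefl v c = _) ▸ h3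

/-- The reflection as a measurable equivalence. -/
def hyperReflEquiv (v : E N) (c : ℝ) (hv : ‖v‖ = 1) : E N ≃ᵐ E N :=
  MeasurableEquiv.ofInvolutive (hyperRefl v c) (hyperRefl_involutive hv)
    (measurePreserving_hyperRefl hv).measurable

/-- The sign of the product tells whether reflecting `y` moves it away from `x` or towards it; all
comparisons of kernel values below come from this identity. -/
theorem norm_sub_hyperRefl_sq (hv : ‖v‖ = 1) (x y : E N) :
    ‖x - hyperRefl v c y‖ ^ 2 =
      ‖x - y‖ ^ 2 + 4 * (inner ℝ v x - c) * (inner ℝ v y - c) := by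
  have : x - hyperRefl v c y = (x - y) + (2 * (inner ℝ v y - c)) • v := by
    rw [hyperRefl]; module
  rw [this, norm_add_sq_real, norm_smul, inner_smul_right, hv, real_inner_comm v (x - y),
    inner_sub_right, mul_one, Real.norm_eq_abs, sq_abs]
  ring

theorem norm_hyperRefl_sq (hv : ‖v‖ = 1) (x : E N) :
    ‖hyperRefl v c x‖ ^ 2 = ‖x‖ ^ 2 - 4 * c * (inner ℝ v x - c) := by
  have h := norm_sub_hyperRefl_sq (c := c) hv 0 x
  simp only [zero_sub, norm_neg, inner_zero_right] at h
  rw [h]; ring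

theorem norm_hyperRefl_sub_hyperRefl (hv : ‖v‖ = 1) (x y : E N) :
    ‖hyperRefl v c x - hyperRefl v c y‖ = ‖x - y‖ := by
  rw [hyperRefl_eq_reflection hv, hyperRefl_eq_reflection hv, add_sub_add_right_eq_sub, ← map_sub,
    LinearIsometryEquiv.norm_map]

theorem norm_hyperRefl_sub (hv : ‖v‖ = 1) (x y : E N) :
    ‖hyperRefl v c x - y‖ = ‖x - hyperRefl v c y‖ := by
  conv_lhs => rw [← hyperRefl_involutive (c := c) hv y]
  rw [norm_hyperRefl_sub_hyperRefl hv]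

theorem norm_sub_le_norm_sub_hyperRefl (hv : ‖v‖ = 1) {x y : E N}
    (h : 0 ≤ (inner ℝ v x - c) * (inner ℝ v y - c)) : ‖x - y‖ ≤ ‖x - hyperRefl v c y‖ := by
  refine le_of_sq_le_sq ?_ (norm_nonneg _)
  rw [norm_sub_hyperRefl_sq hv]; linarith

theorem norm_sub_hyperRefl_le_norm_sub (hv : ‖v‖ = 1) {x y : E N}
    (h : (inner ℝ v x - c) * (inner ℝ v y - c) ≤ 0) : ‖x - hyperRefl v c y‖ ≤ ‖x - y‖ := by
  refine le_of_sq_le_sq ?_ (norm_nonneg _)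
  rw [norm_sub_hyperRefl_sq hv]; linarith

theorem norm_lt_norm_hyperRefl (hv : ‖v‖ = 1) (hc : 0 < c) {x : E N} (h : inner ℝ v x < c) :
    ‖x‖ < ‖hyperRefl v c x‖ := by
  refine lt_of_pow_lt_pow_left₀ 2 (norm_nonneg _) ?_
  rw [norm_hyperRefl_sq hv]
  nlinarith [mul_pos hc (sub_pos.2 h)]

theorem norm_hyperRefl_le_norm (hv : ‖v‖ = 1) (hc : 0 < c) {x : E N} (h : c ≤ inner ℝ v x) :
    ‖hyperRefl v c x‖ ≤ ‖x‖ := by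
  refine le_of_sq_le_sq ?_ (norm_nonneg _)
  rw [norm_hyperRefl_sq hv]
  nlinarith [mul_nonneg hc.le (sub_nonneg.2 h)]

/-- Two points at different distances from the origin are swapped by a reflection whose
hyperplane has the origin on the side of the nearer point. -/
theorem exists_hyperRefl_eq {a b : E N} (h : ‖a‖ < ‖b‖) :
    ∃ (v : E N) (c : ℝ), ‖v‖ = 1 ∧ 0 < c ∧ hyperRefl v c a = b ∧ inner ℝ v a < c := by
  have hd : 0 < ‖b - a‖ := by
    rw [norm_pos_iff, sub_ne_zero]; rintro rfl; exact lt_irrefl _ h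
  have hd' := hd.ne'
  have key : inner ℝ (b - a) (b + a) = ‖b‖ ^ 2 - ‖a‖ ^ 2 := by
    rw [inner_sub_left, inner_add_right, inner_add_right, real_inner_self_eq_norm_sq,
      real_inner_self_eq_norm_sq, real_inner_comm]; ring
  have hsq : ‖a‖ ^ 2 < ‖b‖ ^ 2 := by gcongr
  have hda : inner ℝ (b - a) a = (‖b‖ ^ 2 - ‖a‖ ^ 2 - ‖b - a‖ ^ 2) / 2 := by
    have : inner ℝ (b - a) (b - a) = ‖b - a‖ ^ 2 := real_inner_self_eq_norm_sq _
    rw [inner_sub_right] at this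
    rw [inner_add_right] at key
    linarith
  have hdiff : inner ℝ (‖b - a‖⁻¹ • (b - a)) a - (‖b‖ ^ 2 - ‖a‖ ^ 2) / (2 * ‖b - a‖)
      = - ‖b - a‖ / 2 := by
    rw [real_inner_smul_left, hda]
    field_simp
    ring
  -- The hyperplane is the perpendicular bisector of `a` and `b`; its offset is positive because `b`
  -- is farther from the origin.
  refine ⟨‖b - a‖⁻¹ • (b - a), (‖b‖ ^ 2 - ‖a‖ ^ 2) / (2 * ‖b - a‖), ?_, ?_, ?_, ?_⟩
  · rw [norm_smul, norm_inv, norm_norm, inv_mul_cancel₀ hd']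
  · apply div_pos <;> linarith
  · rw [hyperRefl, hdiff, smul_smul]
    have : 2 * (-‖b - a‖ / 2) * ‖b - a‖⁻¹ = -1 := by field_simp
    rw [this]; module
  · linarith

end Reflection

/-- Densities with values in `[0, 1]` that vanish outside the ball of radius `R`. -/
structure IsDensity {N : ℕ} (R : ℝ) (f : E N → ℝ) : Prop where
  measurable : Measurable f
  nonneg : ∀ x, 0 ≤ f x
  le_one : ∀ x, f x ≤ 1
  eq_zero : ∀ x, R ≤ ‖x‖ → f x = 0

/-- The two-point symmetrization of `f` with respect to a hyperplane. -/
def polarize {N : ℕ} (v : E N) (c : ℝ) (f : E N → ℝ) (x : E N) : ℝ :=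
  if inner ℝ v x < c then max (f x) (f (hyperRefl v c x)) else min (f x) (f (hyperRefl v c x))

/-- The Riesz interaction energy of `f` with kernel `κ(|x - y|)`. -/
def rieszEnergy {N : ℕ} (κ : ℝ → ℝ) (f : E N → ℝ) : ℝ :=
  ∫ p : E N × E N, f p.1 * f p.2 * κ ‖p.1 - p.2‖

/-- Moment of `f` against a strictly radially decreasing weight. -/
def expMoment {N : ℕ} (f : E N → ℝ) : ℝ := ∫ x, f x * Real.exp (-‖x‖)

/-! ### Polarization of densities and its effect on energy and moment -/

section Density

variable {N : ℕ} {R : ℝ} {f : E N → ℝ}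

theorem IsDensity.norm_le_one (hf : IsDensity R f) (x : E N) : ‖f x‖ ≤ 1 := by
  rw [Real.norm_of_nonneg (hf.nonneg x)]; exact hf.le_one x

theorem IsDensity.integrable_mul (hf : IsDensity R f) {g : E N → ℝ} {C : ℝ}
    (hg : Measurable g) (hgC : ∀ x, ‖g x‖ ≤ C) : Integrable (fun x => f x * g x) := by
  have hs : MeasurableSet (Metric.ball (0 : E N) R) := Metric.isOpen_ball.measurableSet
  have h : IntegrableOn (fun x => f x * g x) (Metric.ball 0 R) := by
    refine Measure.integrableOn_of_bounded (M := C) measure_ball_lt_top.ne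
      (hf.measurable.mul hg).aestronglyMeasurable (Eventually.of_forall fun x => ?_)
    rw [norm_mul]
    calc ‖f x‖ * ‖g x‖ ≤ 1 * C := by
          gcongr
          · exact hf.norm_le_one x
          · exact hgC x
      _ = C := one_mul C
  rw [← integrable_indicator_iff hs] at h
  refine h.congr (Eventually.of_forall fun x => ?_)
  by_cases hx : x ∈ Metric.ball (0 : E N) R
  · exact Set.indicator_of_mem hx _
  · rw [Set.indicator_of_notMem hx]
    simp only [hf.eq_zero x (by simpa using hx), zero_mul]

theorem IsDensity.integrable (hf : IsDensity R f) : Integrable f := by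
  simpa using hf.integrable_mul (g := fun _ => 1) (C := 1) measurable_const (by simp)

theorem IsDensity.integrable_exp (hf : IsDensity R f) :
    Integrable (fun x => f x * Real.exp (-‖x‖)) := by
  refine hf.integrable_mul (C := 1) (by fun_prop) fun x => ?_
  rw [Real.norm_of_nonneg (Real.exp_pos _).le]
  exact Real.exp_le_one_iff.2 (by simp)

theorem IsDensity.integrable_energy {κ : ℝ → ℝ} {C : ℝ} (hκ : Antitone κ)
    (hC : ∀ t, 0 ≤ t → ‖κ t‖ ≤ C) {g : E N → ℝ} (hf : IsDensity R f) (hg : IsDensity R g) :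
    Integrable (fun p : E N × E N => f p.1 * g p.2 * κ ‖p.1 - p.2‖) (volume.prod volume) := by
  refine (hf.integrable.mul_prod hg.integrable).mul_bdd (c := C)
    (hκ.measurable.comp (by fun_prop)).aestronglyMeasurable
    (Eventually.of_forall fun p => hC _ (norm_nonneg _))

variable {v : E N} {c : ℝ}

theorem polarize_add (hv : ‖v‖ = 1) (x : E N) :
    polarize v c f x + polarize v c f (hyperRefl v c x) = f x + f (hyperRefl v c x) := by
  have h := inner_hyperRefl (c := c) hv x
  simp only [polarize, hyperRefl_involutive hv x]
  rcases lt_trichotomy (inner ℝ v x) c with hx | hx | hx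
  · rw [if_pos hx, if_neg (by linarith), min_comm, max_add_min]
  · have : hyperRefl v c x = x := by simp [hyperRefl, hx]
    simp [this]
  · rw [if_neg (by linarith), if_pos (by linarith), max_comm, min_add_max]

/-- Positivity of `c` puts the origin on the side that receives the larger values. Mass therefore
moves only towards the origin, and the support stays in the same ball. -/
theorem IsDensity.polarize (hf : IsDensity R f) (hv : ‖v‖ = 1) (hc : 0 < c) :
    IsDensity R (polarize v c f) := by
  have hm := (measurePreserving_hyperRefl (c := c) hv).measurable
  refine ⟨?_, fun x => ?_, fun x => ?_, fun x hx => ?_⟩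
  · refine Measurable.ite (measurableSet_lt (by fun_prop) measurable_const) ?_ ?_
    · exact hf.measurable.max (hf.measurable.comp hm)
    · exact hf.measurable.min (hf.measurable.comp hm)
  · rw [FracSobolev.polarize]; split_ifs
    · exact (hf.nonneg x).trans (le_max_left _ _)
    · exact le_min (hf.nonneg _) (hf.nonneg _)
  · rw [FracSobolev.polarize]; split_ifs
    · exact max_le (hf.le_one _) (hf.le_one _)
    · exact (min_le_left _ _).trans (hf.le_one _)
  · rw [FracSobolev.polarize]; split_ifs with h
    · rw [hf.eq_zero x hx, hf.eq_zero _ (hx.trans (norm_lt_norm_hyperRefl hv hc h).le), max_self]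
    · rw [hf.eq_zero x hx, min_eq_left (hf.nonneg _)]

theorem integral_comp_hyperRefl (hv : ‖v‖ = 1) (g : E N → ℝ) :
    ∫ x, g (hyperRefl v c x) = ∫ x, g x :=
  MeasurePreserving.integral_comp' (f := hyperReflEquiv v c hv)
    (measurePreserving_hyperRefl hv) g

theorem integrable_comp_hyperRefl (hv : ‖v‖ = 1) {g : E N → ℝ} (hg : Integrable g) :
    Integrable (fun x => g (hyperRefl v c x)) :=
  (measurePreserving_hyperRefl hv).integrable_comp_of_integrable hg

theorem integral_polarize (hf : IsDensity R f) (hv : ‖v‖ = 1) (hc : 0 < c) :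
    ∫ x, polarize v c f x = ∫ x, f x := by
  have hp := (hf.polarize hv hc).integrable
  have h : ∫ x, (polarize v c f x + polarize v c f (hyperRefl v c x)) =
      ∫ x, (f x + f (hyperRefl v c x)) := by simp_rw [polarize_add hv]
  rw [integral_add hp (integrable_comp_hyperRefl hv hp),
    integral_add hf.integrable (integrable_comp_hyperRefl hv hf.integrable),
    integral_comp_hyperRefl hv, integral_comp_hyperRefl hv] at h
  linarith

theorem polarize_exp_nonneg (hv : ‖v‖ = 1) (hc : 0 < c) (x : E N) :
    0 ≤ (polarize v c f x - f x) * (Real.exp (-‖x‖) - Real.exp (-‖hyperRefl v c x‖)) := by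
  rw [polarize]; split_ifs with h
  · refine mul_nonneg (sub_nonneg.2 (le_max_left _ _)) (sub_nonneg.2 ?_)
    exact Real.exp_le_exp.2 (neg_le_neg (norm_lt_norm_hyperRefl hv hc h).le)
  · refine mul_nonneg_of_nonpos_of_nonpos (sub_nonpos.2 (min_le_left _ _)) (sub_nonpos.2 ?_)
    exact Real.exp_le_exp.2 (neg_le_neg (norm_hyperRefl_le_norm hv hc (not_lt.1 h)))

/-- Averaging over the pair formed by a point and its mirror image, whose total mass polarization
preserves, turns the gain of moment into an integral with nonnegative integrand. -/
theorem two_mul_expMoment_polarize_sub (hf : IsDensity R f) (hv : ‖v‖ = 1) (hc : 0 < c) :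
    Integrable (fun x => (polarize v c f x - f x) *
      (Real.exp (-‖x‖) - Real.exp (-‖hyperRefl v c x‖))) ∧
    2 * (expMoment (polarize v c f) - expMoment f) =
      ∫ x, (polarize v c f x - f x) * (Real.exp (-‖x‖) - Real.exp (-‖hyperRefl v c x‖)) := by
  have i1 := hf.integrable_exp
  have i2 := (hf.polarize hv hc).integrable_exp
  have i3 : Integrable (fun x => polarize v c f x * Real.exp (-‖x‖) - f x * Real.exp (-‖x‖)) :=
    i2.sub i1
  have i4 := integrable_comp_hyperRefl (c := c) hv i3
  have heq : (fun x => (polarize v c f x - f x) *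
      (Real.exp (-‖x‖) - Real.exp (-‖hyperRefl v c x‖))) =
      fun x => (polarize v c f x * Real.exp (-‖x‖) - f x * Real.exp (-‖x‖)) +
       (polarize v c f (hyperRefl v c x) * Real.exp (-‖hyperRefl v c x‖)
        - f (hyperRefl v c x) * Real.exp (-‖hyperRefl v c x‖)) := by
    ext1 x
    have := polarize_add (c := c) (f := f) hv x
    linear_combination (-Real.exp (-‖hyperRefl v c x‖)) * this
  rw [heq]
  refine ⟨i3.add i4, ?_⟩
  rw [integral_add i3 i4]
  have := integral_comp_hyperRefl (c := c) hv
    (fun x => polarize v c f x * Real.exp (-‖x‖) - f x * Real.exp (-‖x‖))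
  rw [this, integral_sub i2 i1, expMoment, expMoment]
  ring

/-- `f` is larger on the side of the origin, almost everywhere, for every reflection. -/
def IsPolarized (f : E N → ℝ) : Prop :=
  ∀ (v : E N) (c : ℝ), ‖v‖ = 1 → 0 < c →
    ∀ᵐ x, inner ℝ v x < c → f (hyperRefl v c x) ≤ f x

/-- Without gain of moment the nonnegative integrand of `two_mul_expMoment_polarize_sub` vanishes
almost everywhere. The weight is strictly decreasing, so the factor that vanishes strictly inside
the half space is the change of `f`. This equality case is the purpose of the moment. -/
theorem ae_le_of_expMoment_polarize_le (hf : IsDensity R f) (hv : ‖v‖ = 1) (hc : 0 < c)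
    (h : expMoment (polarize v c f) ≤ expMoment f) :
    ∀ᵐ x, inner ℝ v x < c → f (hyperRefl v c x) ≤ f x := by
  obtain ⟨hi, he⟩ := two_mul_expMoment_polarize_sub hf hv hc
  have h0 : ∫ x, (polarize v c f x - f x) *
      (Real.exp (-‖x‖) - Real.exp (-‖hyperRefl v c x‖)) = 0 := by
    refine le_antisymm (by linarith) (integral_nonneg fun x => polarize_exp_nonneg hv hc x)
  rw [integral_eq_zero_iff_of_nonneg (fun x => polarize_exp_nonneg hv hc x) hi] at h0
  filter_upwards [h0] with x hx hxc
  simp only [Pi.zero_apply, mul_eq_zero] at hx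
  rcases hx with hx | hx
  · rw [polarize, if_pos hxc] at hx
    rw [sub_eq_zero] at hx
    exact (le_max_right _ _).trans hx.le
  · exfalso
    have := norm_lt_norm_hyperRefl hv hc hxc
    have := Real.exp_lt_exp.2 (neg_lt_neg this)
    linarith

/-- Symmetrizing over the four ways to reflect the two variables leaves only two kernel values, and
reduces the comparison of energies to a pointwise inequality. -/
theorem four_mul_rieszEnergy {κ : ℝ → ℝ} {C : ℝ} (hκ : Antitone κ)
    (hC : ∀ t, 0 ≤ t → ‖κ t‖ ≤ C) (hf : IsDensity R f) (hv : ‖v‖ = 1) :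
    Integrable (fun p : E N × E N =>
      (f p.1 * f p.2 + f (hyperRefl v c p.1) * f (hyperRefl v c p.2)) * κ ‖p.1 - p.2‖ +
      (f p.1 * f (hyperRefl v c p.2) + f (hyperRefl v c p.1) * f p.2) *
        κ ‖p.1 - hyperRefl v c p.2‖) (volume.prod volume) ∧
    4 * rieszEnergy κ f = ∫ p : E N × E N,
      ((f p.1 * f p.2 + f (hyperRefl v c p.1) * f (hyperRefl v c p.2)) * κ ‖p.1 - p.2‖ +
      (f p.1 * f (hyperRefl v c p.2) + f (hyperRefl v c p.1) * f p.2) *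
        κ ‖p.1 - hyperRefl v c p.2‖) := by
  set F : E N × E N → ℝ := fun p => f p.1 * f p.2 * κ ‖p.1 - p.2‖ with hF
  have i0 : Integrable F (volume.prod volume) := hf.integrable_energy hκ hC hf
  let e := hyperReflEquiv v c hv
  have hmp : MeasurePreserving e volume volume := measurePreserving_hyperRefl hv
  let e1 : E N × E N ≃ᵐ E N × E N := e.prodCongr (MeasurableEquiv.refl _)
  let e2 : E N × E N ≃ᵐ E N × E N := (MeasurableEquiv.refl _).prodCongr e
  let e3 : E N × E N ≃ᵐ E N × E N := e.prodCongr e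
  have m1 : MeasurePreserving e1 (volume.prod volume) (volume.prod volume) :=
    hmp.prod (MeasurePreserving.id _)
  have m2 : MeasurePreserving e2 (volume.prod volume) (volume.prod volume) :=
    (MeasurePreserving.id _).prod hmp
  have m3 : MeasurePreserving e3 (volume.prod volume) (volume.prod volume) :=
    hmp.prod hmp
  have i1 := m1.integrable_comp_of_integrable i0
  have i2 := m2.integrable_comp_of_integrable i0
  have i3 := m3.integrable_comp_of_integrable i0
  have heq : (fun p : E N × E N =>
      (f p.1 * f p.2 + f (hyperRefl v c p.1) * f (hyperRefl v c p.2)) * κ ‖p.1 - p.2‖ +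
      (f p.1 * f (hyperRefl v c p.2) + f (hyperRefl v c p.1) * f p.2) *
        κ ‖p.1 - hyperRefl v c p.2‖) =
      (F + F ∘ e3) + (F ∘ e2 + F ∘ e1) := by
    ext1 p
    simp only [Pi.add_apply]
    have a1 : (F ∘ e1) p = f (hyperRefl v c p.1) * f p.2 * κ ‖hyperRefl v c p.1 - p.2‖ := rfl
    have a2 : (F ∘ e2) p = f p.1 * f (hyperRefl v c p.2) * κ ‖p.1 - hyperRefl v c p.2‖ := rfl
    have a3 : (F ∘ e3) p = f (hyperRefl v c p.1) * f (hyperRefl v c p.2) *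
      κ ‖hyperRefl v c p.1 - hyperRefl v c p.2‖ := rfl
    rw [a1, a2, a3, norm_hyperRefl_sub_hyperRefl hv, norm_hyperRefl_sub hv]
    simp only [hF]
    ring
  have c1 : ∫ p, (F ∘ e1) p ∂(volume.prod volume) = ∫ p, F p ∂(volume.prod volume) :=
    m1.integral_comp' F
  have c2 : ∫ p, (F ∘ e2) p ∂(volume.prod volume) = ∫ p, F p ∂(volume.prod volume) :=
    m2.integral_comp' F
  have c3 : ∫ p, (F ∘ e3) p ∂(volume.prod volume) = ∫ p, F p ∂(volume.prod volume) :=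
    m3.integral_comp' F
  have hJ : rieszEnergy κ f = ∫ p, F p ∂(volume.prod volume) := rfl
  rw [heq]
  refine ⟨(i0.add i3).add (i2.add i1), ?_⟩
  rw [Measure.volume_eq_prod, integral_add' (i0.add i3) (i2.add i1), integral_add' i0 i3,
    integral_add' i2 i1, c1, c2, c3, hJ]
  ring

/-- The two-point rearrangement inequality: pairing large with large gains at least the product of
the two gaps, and this pairing carries the larger weight `k`. -/
theorem max_min_mul_add_le {a b c d k l : ℝ} (hkl : l ≤ k) :
    (a * c + b * d) * k + (a * d + b * c) * l ≤
      (max a b * max c d + min a b * min c d) * k +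
        (max a b * min c d + min a b * max c d) * l := by
  rcases le_total a b with h1 | h1 <;> rcases le_total c d with h2 | h2 <;>
    simp only [max_eq_left, max_eq_right, min_eq_left, min_eq_right, h1, h2] <;>
    nlinarith [mul_nonneg (mul_nonneg (sub_nonneg.2 h1) (sub_nonneg.2 h2)) (sub_nonneg.2 hkl)]

theorem rieszEnergy_le_polarize {κ : ℝ → ℝ} {C : ℝ} (hκ : Antitone κ)
    (hC : ∀ t, 0 ≤ t → ‖κ t‖ ≤ C) (hf : IsDensity R f) (hv : ‖v‖ = 1) (hc : 0 < c) :
    rieszEnergy κ f ≤ rieszEnergy κ (polarize v c f) := by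
  obtain ⟨i1, h1⟩ := four_mul_rieszEnergy (c := c) hκ hC hf hv
  obtain ⟨i2, h2⟩ := four_mul_rieszEnergy (c := c) hκ hC (hf.polarize hv hc) hv
  have h := integral_mono i1 i2 (fun p => ?_)
  · rw [Measure.volume_eq_prod] at h1 h2
    linarith
  rcases p with ⟨x, y⟩
  simp only
  have hx := inner_hyperRefl (c := c) hv x
  have hy := inner_hyperRefl (c := c) hv y
  have near : ∀ z, inner ℝ v z < c →
      polarize v c f z = max (f z) (f (hyperRefl v c z)) ∧
      polarize v c f (hyperRefl v c z) = min (f z) (f (hyperRefl v c z)) := by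
    intro z hz
    have h1 := polarize_add (c := c) (f := f) hv z
    have h2 : polarize v c f z = max (f z) (f (hyperRefl v c z)) := by rw [polarize, if_pos hz]
    refine ⟨h2, ?_⟩
    have := max_add_min (f z) (f (hyperRefl v c z))
    linarith
  have far : ∀ z, ¬ inner ℝ v z < c →
      polarize v c f z = min (f z) (f (hyperRefl v c z)) ∧
      polarize v c f (hyperRefl v c z) = max (f z) (f (hyperRefl v c z)) := by
    intro z hz
    have h1 := polarize_add (c := c) (f := f) hv z
    have h2 : polarize v c f z = min (f z) (f (hyperRefl v c z)) := by rw [polarize, if_neg hz]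
    refine ⟨h2, ?_⟩
    have := max_add_min (f z) (f (hyperRefl v c z))
    linarith
  -- On the same side, `x` is nearer to `y` than to its mirror image, so the direct pairing has the
  -- larger kernel. On opposite sides the two kernel values, and with them the roles of `y` and its
  -- image, are exchanged.
  by_cases cx : inner ℝ v x < c <;> by_cases cy : inner ℝ v y < c
  · rw [(near x cx).1, (near x cx).2, (near y cy).1, (near y cy).2]
    exact max_min_mul_add_le (hκ (norm_sub_le_norm_sub_hyperRefl hv
      (mul_nonneg_of_nonpos_of_nonpos (by linarith) (by linarith))))
  · rw [(near x cx).1, (near x cx).2, (far y cy).1, (far y cy).2]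
    have := max_min_mul_add_le (a := f x) (b := f (hyperRefl v c x)) (c := f (hyperRefl v c y))
      (d := f y) (hκ (norm_sub_hyperRefl_le_norm_sub (c := c) hv (x := x) (y := y)
      (mul_nonpos_of_nonpos_of_nonneg (by linarith) (by linarith))))
    rw [max_comm (f (hyperRefl v c y)), min_comm (f (hyperRefl v c y))] at this
    linarith
  · rw [(far x cx).1, (far x cx).2, (near y cy).1, (near y cy).2]
    have := max_min_mul_add_le (a := f x) (b := f (hyperRefl v c x)) (c := f (hyperRefl v c y))
      (d := f y) (hκ (norm_sub_hyperRefl_le_norm_sub (c := c) hv (x := x) (y := y)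
      (mul_nonpos_of_nonneg_of_nonpos (by linarith) (by linarith))))
    rw [max_comm (f (hyperRefl v c y)), min_comm (f (hyperRefl v c y))] at this
    linarith
  · rw [(far x cx).1, (far x cx).2, (far y cy).1, (far y cy).2]
    have := max_min_mul_add_le (a := f x) (b := f (hyperRefl v c x)) (c := f y)
      (d := f (hyperRefl v c y)) (hκ (norm_sub_le_norm_sub_hyperRefl (c := c) hv (x := x) (y := y)
      (mul_nonneg (by linarith) (by linarith))))
    linarith

end Density

/-! ### Weak compactness of densities -/

section WeakCompactness

variable {N : ℕ} {R : ℝ}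

/-- The open ball of radius `R` as a finite measure space. -/
abbrev ballMeasure (N : ℕ) (R : ℝ) : Measure (E N) := volume.restrict (Metric.ball 0 R)

instance (N : ℕ) (R : ℝ) : IsFiniteMeasure (ballMeasure N R) :=
  ⟨by simpa using measure_ball_lt_top⟩

theorem IsDensity.integral_mul_eq {f : E N → ℝ} (hf : IsDensity R f) (h : E N → ℝ) :
    ∫ x, f x * h x = ∫ x, f x * h x ∂(ballMeasure N R) := by
  refine (setIntegral_eq_integral_of_forall_compl_eq_zero fun x hx => ?_).symm
  rw [hf.eq_zero x (by simpa using hx), zero_mul]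

/-- Densities form a bounded set in `L²` of the ball, so sequential Banach-Alaoglu and Riesz
representation give a weak limit. Testing against indicators shows that the bounds 0 and 1 survive.
-/
theorem exists_weak_limit (f : ℕ → E N → ℝ) (hf : ∀ n, IsDensity R (f n)) :
    ∃ g, IsDensity R g ∧ ∃ φ : ℕ → ℕ, StrictMono φ ∧
      ∀ h : E N → ℝ, Measurable h → ∀ C : ℝ, (∀ x ∈ Metric.ball 0 R, ‖h x‖ ≤ C) →
        Tendsto (fun n => ∫ x, f (φ n) x * h x) atTop (𝓝 (∫ x, g x * h x)) := by
  -- This is what instance search needs for separability of `L²`, and hence for sequential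
  -- compactness.
  have : Fact ((2 : ℝ≥0∞) ≠ ⊤) := ⟨by norm_num⟩
  set μ := ballMeasure N R with hμ
  have hmem : MeasurableSet (Metric.ball (0 : E N) R) := Metric.isOpen_ball.measurableSet
  have hL : ∀ n, MemLp (f n) 2 μ := fun n =>
    MemLp.of_bound (hf n).measurable.aestronglyMeasurable 1
      (Eventually.of_forall (hf n).norm_le_one)
  have h1 : MemLp (fun _ : E N => (1 : ℝ)) 2 μ := memLp_const 1
  let F : ℕ → Lp ℝ 2 μ := fun n => (hL n).toLp
  have hFb : ∀ n, ‖F n‖ ≤ ‖h1.toLp‖ := fun n => by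
    refine Lp.norm_le_norm_of_ae_le ?_
    filter_upwards [(hL n).coeFn_toLp, h1.coeFn_toLp] with x hx1 hx2
    rw [hx1, hx2, norm_one]
    exact (hf n).norm_le_one x
  obtain ⟨w, -, φ, hφ, hw⟩ := WeakDual.isSeqCompact_closedBall ℝ (Lp ℝ 2 μ) 0 ‖h1.toLp‖
    (x := fun n => StrongDual.toWeakDual (innerSL ℝ (F n))) (fun n => by
      simpa [innerSL_apply_norm] using hFb n)
  set G : Lp ℝ 2 μ := (InnerProductSpace.toDual ℝ (Lp ℝ 2 μ)).symm (WeakDual.toStrongDual w)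
    with hG
  have hlim : ∀ H : Lp ℝ 2 μ, Tendsto (fun n => inner ℝ (F (φ n)) H) atTop (𝓝 (inner ℝ G H)) := by
    intro H
    have h2 := ((WeakDual.eval_continuous H).tendsto w).comp hw
    have h3 : inner ℝ G H = w H := by
      rw [hG, InnerProductSpace.toDual_symm_apply]; rfl
    rw [h3]
    exact h2
  have hlim' : ∀ h : E N → ℝ, AEStronglyMeasurable h μ → ∀ C : ℝ, (∀ᵐ x ∂μ, ‖h x‖ ≤ C) →
      Tendsto (fun n => ∫ x, f (φ n) x * h x ∂μ) atTop (𝓝 (∫ x, G x * h x ∂μ)) := by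
    intro h hh C hC
    have hm : MemLp h 2 μ := MemLp.of_bound hh C hC
    have h2 := hlim hm.toLp
    have e1 : ∀ K : Lp ℝ 2 μ, inner ℝ K hm.toLp = ∫ x, K x * h x ∂μ := by
      intro K
      rw [L2.inner_def]
      refine integral_congr_ae ?_
      filter_upwards [hm.coeFn_toLp] with x hx
      rw [hx]; simp [mul_comm]
    rw [e1] at h2
    refine h2.congr fun n => ?_
    rw [e1]
    refine integral_congr_ae ?_
    filter_upwards [(hL (φ n)).coeFn_toLp] with x hx
    rw [hx]
  have hGi : Integrable G μ := (Lp.memLp G).integrable (by norm_num)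
  have hset : ∀ s : Set (E N), MeasurableSet s →
      Tendsto (fun n => ∫ x in s, f (φ n) x ∂μ) atTop (𝓝 (∫ x in s, G x ∂μ)) := by
    intro s hs
    have e1 : ∀ k : E N → ℝ,
        ∫ x, k x * s.indicator (fun _ => (1 : ℝ)) x ∂μ = ∫ x in s, k x ∂μ := by
      intro k
      rw [← integral_indicator hs]
      refine integral_congr_ae (Eventually.of_forall fun x => ?_)
      by_cases hx : x ∈ s <;> simp [hx]
    have := hlim' (s.indicator fun _ => (1 : ℝ))
      ((measurable_const.indicator hs).aestronglyMeasurable) 1 (Eventually.of_forall fun x => by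
        by_cases hx : x ∈ s <;> simp [hx])
    simpa only [e1] using this
  have hfi : ∀ n, Integrable (f n) μ := fun n => (hL n).integrable (by norm_num)
  have hG0 : 0 ≤ᵐ[μ] G := by
    refine ae_nonneg_of_forall_setIntegral_nonneg hGi fun s hs _ => ?_
    exact ge_of_tendsto' (hset s hs) fun n => integral_nonneg fun x => (hf _).nonneg x
  have hG1 : G ≤ᵐ[μ] fun _ => (1 : ℝ) := by
    refine ae_le_of_forall_setIntegral_le hGi (integrable_const 1) fun s hs _ => ?_
    refine le_of_tendsto' (hset s hs) fun n => ?_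
    exact integral_mono (hfi _).integrableOn (integrable_const 1).integrableOn
      fun x => (hf _).le_one x
  have hGm : Measurable G := (Lp.stronglyMeasurable G).measurable
  -- The limit is truncated so that the bounds of a density hold at every point, not only almost
  -- everywhere.
  let g : E N → ℝ := (Metric.ball (0 : E N) R).indicator fun x => min (max (G x) 0) 1
  have hg : IsDensity R g := by
    refine ⟨((hGm.max measurable_const).min measurable_const).indicator hmem, fun x => ?_,
      fun x => ?_, fun x hx => ?_⟩
    · exact Set.indicator_nonneg (fun x _ => le_min (le_max_right _ _) zero_le_one) x
    · exact Set.indicator_le' (fun x _ => min_le_right _ _) (fun x _ => zero_le_one) x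
    · exact Set.indicator_of_notMem (by simpa using hx) _
  have hgG : g =ᵐ[μ] G := by
    filter_upwards [hG0, hG1, ae_restrict_mem hmem] with x hx0 hx1 hx
    simp only [Pi.zero_apply] at hx0
    simp only [g]
    rw [Set.indicator_of_mem hx, max_eq_left hx0, min_eq_left hx1]
  refine ⟨g, hg, φ, hφ, fun h hh C hC => ?_⟩
  simp_rw [fun n => (hf n).integral_mul_eq h, hg.integral_mul_eq h]
  have e2 : ∫ x, g x * h x ∂(ballMeasure N R) = ∫ x, G x * h x ∂μ := by
    refine integral_congr_ae ?_
    filter_upwards [hgG] with x hx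
    rw [hx]
  rw [e2]
  exact hlim' h hh.aestronglyMeasurable C ((ae_restrict_iff' hmem).2 (Eventually.of_forall hC))

/-- The potential `κ(|·|) * f`. -/
def potential (κ : ℝ → ℝ) (f : E N → ℝ) (x : E N) : ℝ := ∫ y, f y * κ ‖x - y‖

variable {κ : ℝ → ℝ} {C : ℝ} {f g : E N → ℝ}

theorem measurable_kernel (hκ : Antitone κ) (x : E N) : Measurable fun y => κ ‖x - y‖ :=
  hκ.measurable.comp (by fun_prop)

theorem measurable_potential (hκ : Antitone κ) (hf : IsDensity R f) :
    Measurable (potential κ f) := by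
  refine (StronglyMeasurable.integral_prod_right' (f := fun p : E N × E N =>
    f p.2 * κ ‖p.1 - p.2‖) ?_).measurable
  exact ((hf.measurable.comp measurable_snd).mul
    (hκ.measurable.comp (by fun_prop))).stronglyMeasurable

theorem norm_potential_le (hC : ∀ t, 0 ≤ t → ‖κ t‖ ≤ C) (hf : IsDensity R f)
    (x : E N) : ‖potential κ f x‖ ≤ C * (∫ y, f y) := by
  rw [← integral_const_mul]
  refine norm_integral_le_of_norm_le (hf.integrable.const_mul C) (Eventually.of_forall fun y => ?_)
  rw [norm_mul, Real.norm_of_nonneg (hf.nonneg y), mul_comm]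
  exact mul_le_mul_of_nonneg_right (hC _ (norm_nonneg _)) (hf.nonneg y)

theorem integral_mul_potential (hκ : Antitone κ) (hC : ∀ t, 0 ≤ t → ‖κ t‖ ≤ C)
    (hf : IsDensity R f) (hg : IsDensity R g) :
    ∫ x, f x * potential κ g x =
      ∫ p : E N × E N, f p.1 * g p.2 * κ ‖p.1 - p.2‖ ∂(volume.prod volume) := by
  rw [integral_prod _ (hf.integrable_energy hκ hC hg)]
  refine integral_congr_ae (Eventually.of_forall fun x => ?_)
  simp only [potential, ← integral_const_mul, mul_assoc]

theorem integral_mul_potential_comm (hκ : Antitone κ) (hC : ∀ t, 0 ≤ t → ‖κ t‖ ≤ C)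
    (hf : IsDensity R f) (hg : IsDensity R g) :
    ∫ x, f x * potential κ g x = ∫ x, g x * potential κ f x := by
  rw [integral_mul_potential hκ hC hf hg, integral_mul_potential hκ hC hg hf,
    ← integral_prod_swap]
  refine integral_congr_ae (Eventually.of_forall fun p => ?_)
  simp only [Prod.fst_swap, Prod.snd_swap]
  rw [norm_sub_rev]; ring

theorem rieszEnergy_eq (hκ : Antitone κ) (hC : ∀ t, 0 ≤ t → ‖κ t‖ ≤ C) (hf : IsDensity R f) :
    rieszEnergy κ f = ∫ x, f x * potential κ f x :=
  (integral_mul_potential hκ hC hf hf).symm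

/-- The energy is quadratic, yet weakly continuous. Each slice of the bounded kernel is an
admissible test function, so the potentials converge pointwise. Dominated convergence on the ball
removes their difference, and the remaining term is linear in the density. -/
theorem tendsto_rieszEnergy (hκ : Antitone κ) (hC : ∀ t, 0 ≤ t → ‖κ t‖ ≤ C)
    {f : ℕ → E N → ℝ} (hf : ∀ n, IsDensity R (f n)) (hg : IsDensity R g)
    (hlim : ∀ h : E N → ℝ, Measurable h → ∀ C : ℝ, (∀ x ∈ Metric.ball 0 R, ‖h x‖ ≤ C) →
        Tendsto (fun n => ∫ x, f n x * h x) atTop (𝓝 (∫ x, g x * h x))) :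
    Tendsto (fun n => rieszEnergy κ (f n)) atTop (𝓝 (rieszEnergy κ g)) := by
  have hC0 : 0 ≤ C := (norm_nonneg _).trans (hC 0 le_rfl)
  have hmem : MeasurableSet (Metric.ball (0 : E N) R) := Metric.isOpen_ball.measurableSet
  set M : ℝ := volume.real (Metric.ball (0 : E N) R)
  have hM : ∀ k : E N → ℝ, IsDensity R k → ∫ y, k y ≤ M := by
    intro k hk
    have := hk.integral_mul_eq (fun _ => 1)
    simp only [mul_one] at this
    rw [this]
    have i1 : Integrable k (ballMeasure N R) := hk.integrable.restrict
    calc ∫ x, k x ∂(ballMeasure N R) ≤ ∫ x, (1 : ℝ) ∂(ballMeasure N R) :=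
          integral_mono i1 (integrable_const 1) fun x => hk.le_one x
      _ = M := by simp [M, Measure.real]
  have hpt : ∀ x, Tendsto (fun n => potential κ (f n) x) atTop (𝓝 (potential κ g x)) := fun x =>
    hlim _ (measurable_kernel hκ x) C fun y _ => hC _ (norm_nonneg _)
  have hb : ∀ k : E N → ℝ, IsDensity R k → ∀ x, ‖potential κ k x‖ ≤ C * M := fun k hk x =>
    (norm_potential_le hC hk x).trans (mul_le_mul_of_nonneg_left (hM k hk) hC0)
  have h2 := hlim (potential κ g) (measurable_potential hκ hg) (C * M) fun x _ => hb g hg x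
  have h1 : Tendsto (fun n => ∫ x, f n x * (potential κ (f n) x - potential κ g x)) atTop
      (𝓝 0) := by
    have e1 : ∀ n, ∫ x, f n x * (potential κ (f n) x - potential κ g x) =
        ∫ x, f n x * (potential κ (f n) x - potential κ g x) ∂(ballMeasure N R) :=
      fun n => (hf n).integral_mul_eq _
    simp_rw [e1]
    have : (0 : ℝ) = ∫ x : E N, (0 : ℝ) ∂(ballMeasure N R) := by simp
    rw [this]
    refine tendsto_integral_of_dominated_convergence (fun _ => C * M + C * M) (fun n => ?_)
      (integrable_const _) (fun n => Eventually.of_forall fun x => ?_)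
      (Eventually.of_forall fun x => ?_)
    · exact ((hf n).measurable.mul ((measurable_potential hκ (hf n)).sub
        (measurable_potential hκ hg))).aestronglyMeasurable
    · rw [norm_mul]
      calc ‖f n x‖ * ‖potential κ (f n) x - potential κ g x‖
          ≤ 1 * (C * M + C * M) := by
            refine mul_le_mul ((hf n).norm_le_one x) ?_ (norm_nonneg _) zero_le_one
            exact (norm_sub_le _ _).trans (add_le_add (hb _ (hf n) x) (hb _ hg x))
        _ = _ := one_mul _
    · have h3 : Tendsto (fun n => ‖potential κ (f n) x - potential κ g x‖) atTop (𝓝 0) := by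
        have := ((hpt x).sub_const (potential κ g x)).norm
        simpa using this
      refine squeeze_zero_norm (fun n => ?_) h3
      rw [norm_mul]
      exact mul_le_of_le_one_left (norm_nonneg _) ((hf n).norm_le_one x)
  have h3 := h1.add h2
  rw [zero_add, ← rieszEnergy_eq hκ hC hg] at h3
  refine h3.congr fun n => ?_
  have i1 : Integrable (fun x => f n x * (potential κ (f n) x - potential κ g x)) :=
    (hf n).integrable_mul ((measurable_potential hκ (hf n)).sub (measurable_potential hκ hg))
      (C := C * M + C * M)
      (fun x => (norm_sub_le _ _).trans (add_le_add (hb _ (hf n) x) (hb _ hg x)))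
  have i2 : Integrable (fun x => f n x * potential κ g x) :=
    (hf n).integrable_mul (measurable_potential hκ hg) (hb g hg)
  rw [rieszEnergy_eq hκ hC (hf n), ← integral_add i1 i2]
  refine integral_congr_ae (Eventually.of_forall fun x => ?_)
  simp only
  ring

theorem rieszEnergy_le (hκ : Antitone κ) (hC : ∀ t, 0 ≤ t → ‖κ t‖ ≤ C) (hf : IsDensity R f) :
    rieszEnergy κ f ≤ C * (∫ x, f x) * ∫ x, f x := by
  have i0 := hf.integrable_energy hκ hC hf
  have i1 := (hf.integrable.mul_prod hf.integrable).const_mul C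
  have := integral_mono i0 i1 fun p => ?_
  · rw [integral_const_mul, integral_prod_mul] at this
    rw [mul_assoc]
    exact this
  · have h1 := (le_abs_self _).trans (hC _ (norm_nonneg (p.1 - p.2)))
    have h2 := mul_nonneg (hf.nonneg p.1) (hf.nonneg p.2)
    simp only
    rw [mul_comm C]
    exact mul_le_mul_of_nonneg_left h1 h2

theorem expMoment_le (hf : IsDensity R f) : expMoment f ≤ ∫ x, f x := by
  refine integral_mono hf.integrable_exp hf.integrable fun x => ?_
  exact mul_le_of_le_one_right (hf.nonneg x) (Real.exp_le_one_iff.2 (by simp))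

/-- The energy `rieszEnergy κ + ε expMoment` is maximized among densities of given mass. -/
theorem exists_maximizer (hκ : Antitone κ) (hC : ∀ t, 0 ≤ t → ‖κ t‖ ≤ C) {ε : ℝ} (hε : 0 < ε)
    {f₀ : E N → ℝ} (h₀ : IsDensity R f₀) :
    ∃ g : E N → ℝ, IsDensity R g ∧ ∫ x, g x = ∫ x, f₀ x ∧
      ∀ f : E N → ℝ, IsDensity R f → ∫ x, f x = ∫ x, f₀ x →
        rieszEnergy κ f + ε * expMoment f ≤ rieszEnergy κ g + ε * expMoment g := by
  set m := ∫ x, f₀ x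
  let S : Set ℝ := {t | ∃ f : E N → ℝ, IsDensity R f ∧ ∫ x, f x = m ∧
    rieszEnergy κ f + ε * expMoment f = t}
  have hSb : BddAbove S := by
    refine ⟨C * m * m + ε * m, ?_⟩
    rintro t ⟨f, hf, hfm, rfl⟩
    rw [← hfm]
    exact add_le_add (rieszEnergy_le hκ hC hf) (mul_le_mul_of_nonneg_left (expMoment_le hf) hε.le)
  obtain ⟨u, -, hu, huS⟩ := exists_seq_tendsto_sSup (S := S) ⟨_, f₀, h₀, rfl, rfl⟩ hSb
  choose f hf hfm hfu using huS
  obtain ⟨g, hg, φ, hφ, hlim⟩ := exists_weak_limit f hf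
  have hmg : ∫ x, g x = m := by
    have h1 := hlim (fun _ => 1) measurable_const 1 (by simp)
    simp only [mul_one, hfm] at h1
    exact (tendsto_nhds_unique h1 tendsto_const_nhds)
  refine ⟨g, hg, hmg, fun k hk hkm => ?_⟩
  have hJ := tendsto_rieszEnergy hκ hC (fun n => hf (φ n)) hg hlim
  have hG : Tendsto (fun n => expMoment (f (φ n))) atTop (𝓝 (expMoment g)) := by
    refine hlim _ (by fun_prop) 1 fun x _ => ?_
    rw [Real.norm_of_nonneg (Real.exp_pos _).le]
    exact Real.exp_le_one_iff.2 (by simp)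
  have h2 := hJ.add (hG.const_mul ε)
  simp only [hfu] at h2
  have h3 := tendsto_nhds_unique h2 (hu.comp hφ.tendsto_atTop)
  rw [h3]
  exact le_csSup hSb ⟨k, hk, hkm, rfl⟩

end WeakCompactness

/-! ### The Riesz rearrangement inequality for one set -/

section Rearrangement

variable {N : ℕ} {R : ℝ} {κ : ℝ → ℝ} {C : ℝ} {f : E N → ℝ}

theorem isDensity_indicator {A : Set (E N)} (hA : MeasurableSet A)
    (h : A ⊆ Metric.ball 0 R) : IsDensity R (A.indicator fun _ => (1 : ℝ)) := by
  refine ⟨measurable_const.indicator hA, fun x => Set.indicator_nonneg (fun _ _ => zero_le_one) x,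
    fun x => Set.indicator_le' (fun _ _ => le_rfl) (fun _ _ => zero_le_one) x, fun x hx => ?_⟩
  refine Set.indicator_of_notMem (fun hxA => ?_) _
  have := h hxA
  rw [mem_ball_zero_iff] at this
  linarith

/-- Polarization preserves mass and does not lower the energy, so at a maximizer it cannot raise the
moment. -/
theorem isPolarized_of_maximizer (hκ : Antitone κ) (hC : ∀ t, 0 ≤ t → ‖κ t‖ ≤ C) {ε : ℝ}
    (hε : 0 < ε) {g : E N → ℝ} (hg : IsDensity R g)
    (hmax : ∀ f : E N → ℝ, IsDensity R f → ∫ x, f x = ∫ x, g x →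
      rieszEnergy κ f + ε * expMoment f ≤ rieszEnergy κ g + ε * expMoment g) :
    IsPolarized g := by
  intro v c hv hc
  refine ae_le_of_expMoment_polarize_le hg hv hc ?_
  have h1 := hmax _ (hg.polarize hv hc) (integral_polarize hg hv hc)
  have h2 := rieszEnergy_le_polarize hκ hC hg hv hc
  exact le_of_mul_le_mul_left (by linarith) hε

theorem isPolarized_ball (r : ℝ) :
    IsPolarized ((Metric.ball (0 : E N) r).indicator fun _ => (1 : ℝ)) := by
  intro v c hv hc
  refine Eventually.of_forall fun x hx => ?_
  have hlt := norm_lt_norm_hyperRefl hv hc hx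
  by_cases h : hyperRefl v c x ∈ Metric.ball (0 : E N) r
  · have h' : x ∈ Metric.ball (0 : E N) r := by
      rw [mem_ball_zero_iff] at h ⊢; exact hlt.trans h
    rw [Set.indicator_of_mem h, Set.indicator_of_mem h']
  · rw [Set.indicator_of_notMem h]
    exact Set.indicator_nonneg (fun _ _ => zero_le_one) _

theorem integrable_mul_kernel (hκ : Antitone κ) (hC : ∀ t, 0 ≤ t → ‖κ t‖ ≤ C)
    (hf : IsDensity R f) (a : E N) : Integrable fun y => f y * κ ‖a - y‖ :=
  hf.integrable_mul (measurable_kernel hκ a) fun _ => hC _ (norm_nonneg _)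

/-- A reflection carries `a` to `b`. Folding the difference of the two potentials along it pairs `f
y - f (hyperRefl v c y)` with a difference of kernel values of the same sign. -/
theorem potential_le_of_norm_lt (hκ : Antitone κ) (hC : ∀ t, 0 ≤ t → ‖κ t‖ ≤ C)
    (hf : IsDensity R f) (hp : IsPolarized f) {a b : E N} (hab : ‖a‖ < ‖b‖) :
    potential κ f b ≤ potential κ f a := by
  obtain ⟨v, c, hv, hc, rfl, ha⟩ := exists_hyperRefl_eq hab
  set b := hyperRefl v c a
  have i1 : Integrable fun y => f y * κ ‖a - y‖ - f y * κ ‖b - y‖ :=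
    (integrable_mul_kernel hκ hC hf a).sub (integrable_mul_kernel hκ hC hf b)
  have i2 := integrable_comp_hyperRefl (c := c) hv i1
  have e1 : potential κ f a - potential κ f b = ∫ y, (f y * κ ‖a - y‖ - f y * κ ‖b - y‖) :=
    (integral_sub (integrable_mul_kernel hκ hC hf a) (integrable_mul_kernel hκ hC hf b)).symm
  have e2 := integral_comp_hyperRefl (c := c) hv
    (fun y => f y * κ ‖a - y‖ - f y * κ ‖b - y‖)
  have e3 := integral_add i1 i2
  rw [e2, ← e1] at e3
  have h0 : 0 ≤ ∫ y, (f y * κ ‖a - y‖ - f y * κ ‖b - y‖ + (f (hyperRefl v c y) *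
      κ ‖a - hyperRefl v c y‖ - f (hyperRefl v c y) * κ ‖b - hyperRefl v c y‖)) := by
    refine integral_nonneg_of_ae ?_
    have hae := hp v c hv hc
    have hae' := (measurePreserving_hyperRefl (c := c) hv).quasiMeasurePreserving.ae hae
    filter_upwards [hae, hae'] with y hy hy'
    have n1 : ‖b - hyperRefl v c y‖ = ‖a - y‖ := norm_hyperRefl_sub_hyperRefl hv a y
    have n2 : ‖b - y‖ = ‖a - hyperRefl v c y‖ := norm_hyperRefl_sub hv a y
    rw [n1, n2]
    have hin := inner_hyperRefl (c := c) hv y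
    rw [hyperRefl_involutive hv y] at hy'
    simp only [Pi.zero_apply]
    rcases lt_trichotomy (inner ℝ v y) c with h | h | h
    · have h1 := hy h
      have h2 := hκ (norm_sub_le_norm_sub_hyperRefl (c := c) hv (x := a) (y := y)
        (mul_nonneg_of_nonpos_of_nonpos (by linarith) (by linarith)))
      nlinarith [mul_nonneg (sub_nonneg.2 h1) (sub_nonneg.2 h2)]
    · have : hyperRefl v c y = y := by simp [hyperRefl, h]
      rw [this]; linarith
    · have h1 := hy' (by linarith)
      have h2 := hκ (norm_sub_hyperRefl_le_norm_sub (c := c) hv (x := a) (y := y)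
        (mul_nonpos_of_nonpos_of_nonneg (by linarith) (by linarith)))
      nlinarith [mul_nonneg (sub_nonneg.2 h1) (sub_nonneg.2 h2)]
  linarith

/-- The bathtub principle. -/
theorem integral_mul_le_ball {r : ℝ} (hr : 0 < r) (hrR : r ≤ R) (hf : IsDensity R f)
    (hm : ∫ x, f x = ∫ x, (Metric.ball (0 : E N) r).indicator (fun _ => (1 : ℝ)) x)
    {h : E N → ℝ} (hh : Measurable h) {M : ℝ} (hM : ∀ x, ‖h x‖ ≤ M)
    (hmono : ∀ a b : E N, ‖a‖ < ‖b‖ → h b ≤ h a) :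
    ∫ x, f x * h x ≤ ∫ x, (Metric.ball (0 : E N) r).indicator (fun _ => (1 : ℝ)) x * h x := by
  set χ := (Metric.ball (0 : E N) r).indicator (fun _ => (1 : ℝ)) with hχ
  have dχ : IsDensity R χ :=
    isDensity_indicator Metric.isOpen_ball.measurableSet (Metric.ball_subset_ball hrR)
  -- The threshold `t` separates the values of `h` inside the ball from those outside, so `(χ - f) *
  -- (h - t)` is nonnegative; equal masses cancel the term with `t`.
  set t := sInf (h '' Metric.ball 0 r)
  have hbb : BddBelow (h '' Metric.ball 0 r) := by
    refine ⟨-M, ?_⟩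
    rintro _ ⟨x, -, rfl⟩
    exact (abs_le.1 (hM x)).1
  have hin : ∀ x, ‖x‖ < r → t ≤ h x := fun x hx => csInf_le hbb ⟨x, by simpa using hx, rfl⟩
  have hout : ∀ x, r ≤ ‖x‖ → h x ≤ t := by
    intro x hx
    refine le_csInf ⟨_, 0, by simpa using hr, rfl⟩ ?_
    rintro _ ⟨y, hy, rfl⟩
    rw [mem_ball_zero_iff] at hy
    exact hmono _ _ (hy.trans_le hx)
  have i1 := hf.integrable_mul hh hM
  have i2 := dχ.integrable_mul hh hM
  have i3 : Integrable fun x => (χ x - f x) * t := (dχ.integrable.sub hf.integrable).mul_const t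
  have i4 : Integrable fun x => χ x * h x - f x * h x := i2.sub i1
  have h0 : 0 ≤ ∫ x, ((χ x * h x - f x * h x) - (χ x - f x) * t) := by
    refine integral_nonneg fun x => ?_
    simp only [Pi.zero_apply]
    by_cases hx : ‖x‖ < r
    · have : χ x = 1 := Set.indicator_of_mem (by simpa using hx) _
      have h1 := hf.le_one x
      have h2 := hin x hx
      rw [this]
      nlinarith [mul_nonneg (sub_nonneg.2 h1) (sub_nonneg.2 h2)]
    · have : χ x = 0 := Set.indicator_of_notMem (by simpa using hx) _
      have h1 := hf.nonneg x
      have h2 := hout x (not_lt.1 hx)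
      rw [this]
      nlinarith [mul_nonneg h1 (sub_nonneg.2 h2)]
  rw [integral_sub i4 i3, integral_sub i2 i1, integral_mul_const, integral_sub dχ.integrable hf.integrable, hm,
    sub_self, zero_mul] at h0
  linarith

/-- The bathtub principle replaces one factor `f` by the ball against the potential of `f`. By
symmetry of the interaction it then replaces the other one against the potential of the ball. Both
potentials are radially nonincreasing. -/
theorem rieszEnergy_le_ball_of_isPolarized (hκ : Antitone κ) (hC : ∀ t, 0 ≤ t → ‖κ t‖ ≤ C)
    {r : ℝ} (hr : 0 < r) (hrR : r ≤ R) (hf : IsDensity R f) (hp : IsPolarized f)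
    (hm : ∫ x, f x = ∫ x, (Metric.ball (0 : E N) r).indicator (fun _ => (1 : ℝ)) x) :
    rieszEnergy κ f ≤ rieszEnergy κ ((Metric.ball (0 : E N) r).indicator fun _ => (1 : ℝ)) := by
  have dχ : IsDensity R ((Metric.ball (0 : E N) r).indicator fun _ => (1 : ℝ)) :=
    isDensity_indicator Metric.isOpen_ball.measurableSet (Metric.ball_subset_ball hrR)
  rw [rieszEnergy_eq hκ hC hf, rieszEnergy_eq hκ hC dχ]
  refine (integral_mul_le_ball hr hrR hf hm (measurable_potential hκ hf)
    (norm_potential_le hC hf) fun a b h => potential_le_of_norm_lt hκ hC hf hp h).trans ?_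
  rw [integral_mul_potential_comm hκ hC dχ hf]
  exact integral_mul_le_ball hr hrR hf hm (measurable_potential hκ dχ)
    (norm_potential_le hC dχ) fun a b h =>
      potential_le_of_norm_lt hκ hC dχ (isPolarized_ball r) h

/-- Among densities of given mass, the indicator of the ball maximizes the Riesz energy. -/
theorem rieszEnergy_le_ball (hκ : Antitone κ) (hC : ∀ t, 0 ≤ t → ‖κ t‖ ≤ C)
    {r : ℝ} (hr : 0 < r) (hrR : r ≤ R) (hf : IsDensity R f)
    (hm : ∫ x, f x = ∫ x, (Metric.ball (0 : E N) r).indicator (fun _ => (1 : ℝ)) x) :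
    rieszEnergy κ f ≤ rieszEnergy κ ((Metric.ball (0 : E N) r).indicator fun _ => (1 : ℝ)) := by
  set χ := (Metric.ball (0 : E N) r).indicator (fun _ => (1 : ℝ)) with hχ
  -- The energy alone need not show that a maximizer is polarized; the perturbed functional does,
  -- and its error vanishes with `ε`.
  have key : ∀ ε : ℝ, 0 < ε →
      rieszEnergy κ f ≤ rieszEnergy κ χ + ε * (expMoment χ - expMoment f) := by
    intro ε hε
    obtain ⟨g, hg, hgm, hmax⟩ := exists_maximizer hκ hC hε hf
    have hp : IsPolarized g := isPolarized_of_maximizer hκ hC hε hg fun k hk hkm =>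
      hmax k hk (hkm.trans hgm)
    have h1 := hmax f hf rfl
    have h2 := rieszEnergy_le_ball_of_isPolarized hκ hC hr hrR hg hp (hgm.trans hm)
    have h3 : expMoment g ≤ expMoment χ :=
      integral_mul_le_ball hr hrR hg (hgm.trans hm) (by fun_prop) (M := 1)
        (fun x => by
          rw [Real.norm_of_nonneg (Real.exp_pos _).le]
          exact Real.exp_le_one_iff.2 (by simp))
        fun a b h => Real.exp_le_exp.2 (neg_le_neg h.le)
    nlinarith [mul_le_mul_of_nonneg_left h3 hε.le]
  have hlim : Tendsto (fun ε : ℝ => rieszEnergy κ χ + ε * (expMoment χ - expMoment f))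
      (𝓝[>] 0) (𝓝 (rieszEnergy κ χ)) := by
    have h : Continuous fun ε : ℝ => rieszEnergy κ χ + ε * (expMoment χ - expMoment f) := by
      fun_prop
    have := (h.tendsto 0).mono_left (nhdsWithin_le_nhds (s := Set.Ioi 0))
    simpa using this
  exact ge_of_tendsto hlim (by filter_upwards [self_mem_nhdsWithin] with ε hε using key ε hε)

/-- The measure on pairs of points with density `κ(|x - y|)`. -/
def pairMeasure (N : ℕ) (κ : ℝ → ℝ) : Measure (E N × E N) :=
  (volume.prod volume).withDensity fun p => ENNReal.ofReal (κ ‖p.1 - p.2‖)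

theorem measurable_pair_kernel (hκ : Measurable κ) :
    Measurable fun p : E N × E N => ENNReal.ofReal (κ ‖p.1 - p.2‖) :=
  (hκ.comp (by fun_prop)).ennreal_ofReal

theorem pairMeasure_prod_self (hκ : Antitone κ) (h0 : ∀ t, 0 ≤ κ t) (hC : ∀ t, 0 ≤ t → ‖κ t‖ ≤ C)
    {A : Set (E N)} (hA : MeasurableSet A) (hAR : A ⊆ Metric.ball 0 R) :
    pairMeasure N κ (A ×ˢ A) = ENNReal.ofReal (rieszEnergy κ (A.indicator fun _ => (1 : ℝ))) := by
  have hd := isDensity_indicator hA hAR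
  rw [pairMeasure, withDensity_apply _ (hA.prod hA), ← lintegral_indicator (hA.prod hA),
    rieszEnergy, Measure.volume_eq_prod, ofReal_integral_eq_lintegral_ofReal (hd.integrable_energy hκ hC hd)]
  · refine lintegral_congr fun p => ?_
    by_cases h1 : p.1 ∈ A <;> by_cases h2 : p.2 ∈ A <;> simp [h1, h2]
  · exact Eventually.of_forall fun p =>
      mul_nonneg (mul_nonneg (hd.nonneg _) (hd.nonneg _)) (h0 _)

theorem volume_ball_zero (hN : 1 ≤ N) {r : ℝ} (hr : 0 ≤ r) :
    volume (Metric.ball (0 : E N) r) =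
      ENNReal.ofReal (r ^ N) * volume (Metric.ball (0 : E N) 1) := by
  have : Nonempty (Fin N) := ⟨⟨0, hN⟩⟩
  have := Measure.addHaar_ball (volume : Measure (E N)) 0 hr
  simpa using this

theorem exists_volume_ball_eq (hN : 1 ≤ N) {m : ℝ≥0∞} (hm0 : m ≠ 0) (hm : m ≠ ⊤) :
    ∃ r : ℝ, 0 < r ∧ volume (Metric.ball (0 : E N) r) = m := by
  have hb0 : volume (Metric.ball (0 : E N) 1) ≠ 0 :=
    (Metric.measure_ball_pos _ _ one_pos).ne'
  have hbt : volume (Metric.ball (0 : E N) 1) ≠ ⊤ := measure_ball_lt_top.ne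
  set q := m / volume (Metric.ball (0 : E N) 1) with hq
  have hq0 : 0 < q.toReal := ENNReal.toReal_pos (ENNReal.div_ne_zero.2 ⟨hm0, hbt⟩)
    (ENNReal.div_ne_top hm hb0)
  refine ⟨q.toReal ^ (1 / (N : ℝ)), Real.rpow_pos_of_pos hq0 _, ?_⟩
  rw [volume_ball_zero hN (Real.rpow_nonneg hq0.le _), ← Real.rpow_natCast, ← Real.rpow_mul hq0.le,
    one_div_mul_cancel (by positivity), Real.rpow_one,
    ENNReal.ofReal_toReal (ENNReal.div_ne_top hm hb0), ENNReal.div_mul_cancel hb0 hbt]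

theorem radius_le_of_volume_ball_le (hN : 1 ≤ N) {r r' : ℝ} (hr' : 0 ≤ r')
    (h : volume (Metric.ball (0 : E N) r) ≤ volume (Metric.ball (0 : E N) r')) : r ≤ r' := by
  by_contra! hlt
  have hb0 : volume (Metric.ball (0 : E N) 1) ≠ 0 :=
    (Metric.measure_ball_pos _ _ one_pos).ne'
  have hbt : volume (Metric.ball (0 : E N) 1) ≠ ⊤ := measure_ball_lt_top.ne
  rw [volume_ball_zero hN hr', volume_ball_zero hN (hr'.trans hlt.le)] at h
  have h2 := (ENNReal.mul_le_mul_iff_left hb0 hbt).1 h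
  have hp : r' ^ N < r ^ N := pow_lt_pow_left₀ hlt hr' (by omega)
  rw [ENNReal.ofReal_le_ofReal_iff (by positivity)] at h2
  linarith

theorem pairMeasure_prod_self_le_ball_of_bounded (hN : 1 ≤ N) (hκ : Antitone κ)
    (h0 : ∀ t, 0 ≤ κ t) (hC : ∀ t, 0 ≤ t → ‖κ t‖ ≤ C) {A : Set (E N)} (hA : MeasurableSet A)
    (hAR : A ⊆ Metric.ball 0 R) {r : ℝ} (hr : 0 < r)
    (hv : volume A ≤ volume (Metric.ball (0 : E N) r)) :
    pairMeasure N κ (A ×ˢ A) ≤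
      pairMeasure N κ (Metric.ball (0 : E N) r ×ˢ Metric.ball (0 : E N) r) := by
  by_cases hA0 : volume A = 0
  · have : pairMeasure N κ (A ×ˢ A) = 0 := by
      refine withDensity_absolutelyContinuous _ _ ?_
      rw [Measure.prod_prod, hA0, zero_mul]
    rw [this]; exact zero_le
  have hAt : volume A ≠ ⊤ := (hv.trans_lt measure_ball_lt_top).ne
  obtain ⟨r', hr', hvr⟩ := exists_volume_ball_eq hN hA0 hAt
  have hrr : r' ≤ r := radius_le_of_volume_ball_le hN hr.le (hvr.trans_le hv)
  set R' := max R r'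
  have hAR' : A ⊆ Metric.ball 0 R' := hAR.trans (Metric.ball_subset_ball (le_max_left _ _))
  have h1 := rieszEnergy_le_ball hκ hC hr' (le_max_right R r') (isDensity_indicator hA hAR') (by
    rw [integral_indicator hA, integral_indicator Metric.isOpen_ball.measurableSet]
    simp [Measure.real, hvr])
  refine le_trans ?_ (measure_mono (Set.prod_mono (Metric.ball_subset_ball hrr)
    (Metric.ball_subset_ball hrr)))
  rw [pairMeasure_prod_self hκ h0 hC hA hAR', pairMeasure_prod_self hκ h0 hC
    Metric.isOpen_ball.measurableSet (Metric.ball_subset_ball (le_max_right R r'))]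
  exact ENNReal.ofReal_le_ofReal h1

theorem pairMeasure_prod_self_le_ball (hN : 1 ≤ N) (hκ : Antitone κ)
    (h0 : ∀ t, 0 ≤ κ t) (hC : ∀ t, 0 ≤ t → ‖κ t‖ ≤ C) {A : Set (E N)} (hA : MeasurableSet A)
    {r : ℝ} (hr : 0 < r) (hv : volume A ≤ volume (Metric.ball (0 : E N) r)) :
    pairMeasure N κ (A ×ˢ A) ≤
      pairMeasure N κ (Metric.ball (0 : E N) r ×ˢ Metric.ball (0 : E N) r) := by
  -- Weak compactness needs bounded support, so a general set is exhausted by its bounded pieces.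
  let B : ℕ → Set (E N) := fun n => A ∩ Metric.ball 0 n
  have hB : Monotone B := fun m n h => Set.inter_subset_inter_right _
    (Metric.ball_subset_ball (by exact_mod_cast h))
  have hU : A ×ˢ A = ⋃ n, B n ×ˢ B n := by
    rw [Set.iUnion_prod_of_monotone hB hB]
    have : ⋃ n, B n = A := by
      rw [← Set.inter_iUnion, Metric.iUnion_ball_nat, Set.inter_univ]
    rw [this]
  rw [hU, (hB.set_prod hB).measure_iUnion]
  refine iSup_le fun n => ?_
  exact pairMeasure_prod_self_le_ball_of_bounded hN hκ h0 hC
    (hA.inter Metric.isOpen_ball.measurableSet) Set.inter_subset_right hr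
    ((measure_mono Set.inter_subset_left).trans hv)

theorem pairMeasure_prod_univ (hκ : Measurable κ) {A : Set (E N)} (hA : MeasurableSet A) :
    pairMeasure N κ (A ×ˢ Set.univ) =
      (∫⁻ z : E N, ENNReal.ofReal (κ ‖z‖)) * volume A := by
  rw [pairMeasure, withDensity_apply _ (hA.prod MeasurableSet.univ), ← Measure.prod_restrict,
    Measure.restrict_univ, lintegral_prod _ (measurable_pair_kernel hκ).aemeasurable]
  have : ∀ x : E N, ∫⁻ y : E N, ENNReal.ofReal (κ ‖x - y‖) =
      ∫⁻ z : E N, ENNReal.ofReal (κ ‖z‖) := fun x =>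
    lintegral_sub_left_eq_self (fun z : E N => ENNReal.ofReal (κ ‖z‖)) x
  simp only [this, lintegral_const, Measure.restrict_apply_univ]

/-- Balls minimize the nonlocal perimeter with an integrable kernel. -/
theorem pairMeasure_ball_prod_compl_le (hN : 1 ≤ N) (hκ : Antitone κ)
    (h0 : ∀ t, 0 ≤ κ t) (hC : ∀ t, 0 ≤ t → ‖κ t‖ ≤ C)
    (hfin : ∫⁻ z : E N, ENNReal.ofReal (κ ‖z‖) ≠ ⊤) {A : Set (E N)} (hA : MeasurableSet A)
    {r : ℝ} (hr : 0 < r) (hv : volume A = volume (Metric.ball (0 : E N) r)) :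
    pairMeasure N κ (Metric.ball (0 : E N) r ×ˢ (Metric.ball (0 : E N) r)ᶜ) ≤
      pairMeasure N κ (A ×ˢ Aᶜ) := by
  -- Interaction with the whole space depends only on volume, so maximal self-interaction means
  -- minimal perimeter. Integrability of the kernel permits the cancellation below.
  have split : ∀ {D : Set (E N)}, MeasurableSet D →
      pairMeasure N κ (D ×ˢ D) + pairMeasure N κ (D ×ˢ Dᶜ) =
        (∫⁻ z : E N, ENNReal.ofReal (κ ‖z‖)) * volume D := by
    intro D hD
    rw [← pairMeasure_prod_univ hκ.measurable hD, ← measure_union _ (hD.prod hD.compl),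
      ← Set.prod_union, Set.union_compl_self]
    exact Set.Disjoint.set_prod_right disjoint_compl_right _ _
  have hb : MeasurableSet (Metric.ball (0 : E N) r) := Metric.isOpen_ball.measurableSet
  have e1 := split hA
  have e2 := split hb
  have h1 := pairMeasure_prod_self_le_ball hN hκ h0 hC hA hr hv.le
  rw [hv, ← e2] at e1
  have hft : pairMeasure N κ (Metric.ball (0 : E N) r ×ˢ Metric.ball (0 : E N) r) ≠ ⊤ := by
    refine ne_top_of_le_ne_top (ENNReal.mul_ne_top hfin (measure_ball_lt_top
      (μ := volume) (x := (0 : E N)) (r := r)).ne) ?_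
    rw [← e2]; exact le_self_add
  have h2 : pairMeasure N κ (Metric.ball (0 : E N) r ×ˢ Metric.ball (0 : E N) r) +
      pairMeasure N κ (Metric.ball (0 : E N) r ×ˢ (Metric.ball (0 : E N) r)ᶜ) ≤
      pairMeasure N κ (Metric.ball (0 : E N) r ×ˢ Metric.ball (0 : E N) r) +
      pairMeasure N κ (A ×ˢ Aᶜ) := by
    rw [← e1]; gcongr
  exact (ENNReal.add_le_add_iff_left hft).1 h2

end Rearrangement

/-! ### The fractional perimeter -/

section Perimeter

variable {N : ℕ} {s : ℝ}

/-- The profile `t ^ (-(N + s))` of the fractional kernel. -/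
def fracKernel (N : ℕ) (s t : ℝ) : ℝ := t ^ (-((N : ℝ) + s))

/-- The fractional kernel cut off near the diagonal. -/
def cutKernel (N : ℕ) (s : ℝ) (n : ℕ) (t : ℝ) : ℝ := fracKernel N s (max t (1 / ((n : ℝ) + 1)))

/-- The real-valued characteristic function of a set. -/
abbrev ind (A : Set (E N)) : E N → ℝ := A.indicator fun _ => (1 : ℝ)

theorem measurable_fracKernel (N : ℕ) (s : ℝ) : Measurable (fracKernel N s) := by
  unfold fracKernel; fun_prop

theorem gagliardo_congr {u v : E N → ℝ} (h : u =ᵐ[volume] v) : gagliardo s u = gagliardo s v := by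
  refine lintegral_congr_ae ?_
  filter_upwards [h] with x hx
  refine lintegral_congr_ae ?_
  filter_upwards [h] with y hy
  rw [hx, hy]

theorem gagliardo_integrand (a : ℝ) (z : E N) :
    ENNReal.ofReal (|a| / ‖z‖ ^ ((N : ℝ) + s)) =
      ENNReal.ofReal (fracKernel N s ‖z‖) * ‖a‖ₑ := by
  rw [fracKernel, Real.rpow_neg (norm_nonneg _), div_eq_inv_mul, ENNReal.ofReal_mul (by positivity),
    Real.enorm_eq_ofReal_abs]

/-- The seminorm becomes an `L¹` norm on pairs, to which Tonelli and Scheffé apply. -/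
theorem gagliardo_eq_lintegral_pair {u : E N → ℝ} (hu : Measurable u) :
    gagliardo s u = ∫⁻ p, ‖u p.1 - u p.2‖ₑ ∂(pairMeasure N (fracKernel N s)) := by
  have h1 := measurable_pair_kernel (N := N) (measurable_fracKernel N s)
  have h2 : Measurable fun p : E N × E N => ‖u p.1 - u p.2‖ₑ := by fun_prop
  rw [pairMeasure, lintegral_withDensity_eq_lintegral_mul _ h1 h2,
    lintegral_prod _ (h1.mul h2).aemeasurable, gagliardo]
  simp only [gagliardo_integrand, Pi.mul_apply]

theorem pairMeasure_prod_swap {κ : ℝ → ℝ} {A B : Set (E N)} (hA : MeasurableSet A)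
    (hB : MeasurableSet B) :
    pairMeasure N κ (A ×ˢ B) = pairMeasure N κ (B ×ˢ A) := by
  rw [pairMeasure, withDensity_apply _ (hA.prod hB), withDensity_apply _ (hB.prod hA),
    ← lintegral_indicator (hA.prod hB), ← lintegral_indicator (hB.prod hA), ← lintegral_prod_swap]
  refine lintegral_congr fun p => ?_
  by_cases h1 : p.1 ∈ B <;> by_cases h2 : p.2 ∈ A <;> simp [Set.indicator, h1, h2, norm_sub_rev]

theorem gagliardo_ind {A : Set (E N)} (hA : MeasurableSet A) :
    gagliardo s (ind A) = 2 * pairMeasure N (fracKernel N s) (A ×ˢ Aᶜ) := by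
  rw [gagliardo_eq_lintegral_pair (measurable_const.indicator hA)]
  have : ∀ p : E N × E N, ‖ind A p.1 - ind A p.2‖ₑ =
      (A ×ˢ Aᶜ).indicator 1 p + (Aᶜ ×ˢ A).indicator 1 p := by
    intro p
    by_cases h1 : p.1 ∈ A <;> by_cases h2 : p.2 ∈ A <;> simp [Set.indicator, h1, h2]
  simp only [this]
  rw [lintegral_add_left (measurable_one.indicator (hA.prod hA.compl)),
    lintegral_indicator_one (hA.prod hA.compl), lintegral_indicator_one (hA.compl.prod hA),
    pairMeasure_prod_swap hA.compl hA, two_mul]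

theorem fracKernel_nonneg {t : ℝ} (ht : 0 ≤ t) : 0 ≤ fracKernel N s t := Real.rpow_nonneg ht _

theorem fracKernel_le (hs : 0 < s) {a b : ℝ} (ha : 0 < a) (hab : a ≤ b) :
    fracKernel N s b ≤ fracKernel N s a :=
  Real.rpow_le_rpow_of_nonpos ha hab (by have := Nat.cast_nonneg (α := ℝ) N; linarith)

theorem cut_pos (n : ℕ) (t : ℝ) : 0 < max t (1 / ((n : ℝ) + 1)) :=
  lt_max_of_lt_right (by positivity)

/-- The cut keeps the argument positive, so monotonicity holds on the whole real line. The uncut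
power fails this already at 0, where its value is 0 by convention. -/
theorem antitone_cutKernel (hs : 0 < s) (n : ℕ) : Antitone (cutKernel N s n) := fun _ _ h =>
  fracKernel_le hs (cut_pos n _) (max_le_max_right _ h)

theorem cutKernel_nonneg (n : ℕ) (t : ℝ) : 0 ≤ cutKernel N s n t :=
  fracKernel_nonneg (cut_pos n t).le

theorem norm_cutKernel_le (hs : 0 < s) (n : ℕ) (t : ℝ) (ht : 0 ≤ t) :
    ‖cutKernel N s n t‖ ≤ cutKernel N s n 0 := by
  rw [Real.norm_of_nonneg (cutKernel_nonneg n t)]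
  exact antitone_cutKernel hs n ht

theorem cutKernel_mono (hs : 0 < s) (t : ℝ) : Monotone fun n => cutKernel N s n t := fun m n h =>
  fracKernel_le hs (cut_pos n _) (max_le_max_left _ (by gcongr))

theorem cutKernel_le (hs : 0 < s) (n : ℕ) {t : ℝ} (ht : 0 < t) :
    cutKernel N s n t ≤ fracKernel N s t := fracKernel_le hs ht (le_max_left _ _)

theorem exists_cutKernel_eq {t : ℝ} (ht : 0 < t) : ∃ n, cutKernel N s n t = fracKernel N s t := by
  obtain ⟨n, hn⟩ := exists_nat_one_div_lt ht
  exact ⟨n, by rw [cutKernel, max_eq_left hn.le]⟩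

theorem lintegral_cutKernel_ne_top (hs : 0 < s) (n : ℕ) :
    ∫⁻ z : E N, ENNReal.ofReal (cutKernel N s n ‖z‖) ≠ ⊤ := by
  set δ : ℝ := 1 / ((n : ℝ) + 1) with hδ
  have hδ0 : 0 < δ := by positivity
  have hr : (Module.finrank ℝ (E N) : ℝ) < (N : ℝ) + s := by simpa using hs
  have h1 := (integrable_one_add_norm (μ := (volume : Measure (E N))) hr).const_mul
    ((δ / (1 + δ)) ^ (-((N : ℝ) + s)))
  -- The comparison is `max ‖z‖ δ ≥ δ / (1 + δ) * (1 + ‖z‖)`, raised to a negative power beyond the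
  -- dimension.
  refine (lt_of_le_of_lt (lintegral_mono fun z => ?_) h1.lintegral_lt_top).ne
  refine ENNReal.ofReal_le_ofReal ?_
  rw [← Real.mul_rpow (by positivity) (by positivity)]
  refine Real.rpow_le_rpow_of_nonpos (by positivity) ?_ (by
    have := Nat.cast_nonneg (α := ℝ) N; linarith)
  rw [div_mul_eq_mul_div, div_le_iff₀ (by positivity)]
  rcases le_total ‖z‖ δ with h | h
  · rw [max_eq_right h]; nlinarith
  · rw [max_eq_left h]; nlinarith

theorem pairMeasure_cutKernel_le (hs : 0 < s) (n : ℕ) {A B : Set (E N)} (hA : MeasurableSet A)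
    (hB : MeasurableSet B) (hd : Disjoint A B) :
    pairMeasure N (cutKernel N s n) (A ×ˢ B) ≤ pairMeasure N (fracKernel N s) (A ×ˢ B) := by
  rw [pairMeasure, pairMeasure, withDensity_apply _ (hA.prod hB), withDensity_apply _ (hA.prod hB)]
  refine setLIntegral_mono (measurable_pair_kernel (measurable_fracKernel N s)) fun p hp => ?_
  refine ENNReal.ofReal_le_ofReal (cutKernel_le hs n ?_)
  rw [norm_pos_iff, sub_ne_zero]
  exact hd.ne_of_mem hp.1 hp.2

/-- Disjoint sets avoid the diagonal, where every pair eventually sees the uncut kernel; monotone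
convergence does the rest. -/
theorem pairMeasure_fracKernel_eq_iSup (hs : 0 < s) {A B : Set (E N)} (hA : MeasurableSet A)
    (hB : MeasurableSet B) (hd : Disjoint A B) :
    pairMeasure N (fracKernel N s) (A ×ˢ B) = ⨆ n, pairMeasure N (cutKernel N s n) (A ×ˢ B) := by
  simp only [pairMeasure]
  simp_rw [withDensity_apply _ (hA.prod hB)]
  rw [← lintegral_iSup (fun n => measurable_pair_kernel (antitone_cutKernel hs n).measurable)]
  · refine setLIntegral_congr_fun (hA.prod hB) fun p hp => ?_
    have hpos : 0 < ‖p.1 - p.2‖ := by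
      rw [norm_pos_iff, sub_ne_zero]
      exact hd.ne_of_mem hp.1 hp.2
    obtain ⟨n, hn⟩ := exists_cutKernel_eq (N := N) (s := s) hpos
    refine le_antisymm ?_ (iSup_le fun n => ENNReal.ofReal_le_ofReal (cutKernel_le hs n hpos))
    rw [← hn]
    exact le_iSup (fun n => ENNReal.ofReal (cutKernel N s n ‖p.1 - p.2‖)) n
  · exact fun m n h p => ENNReal.ofReal_le_ofReal (cutKernel_mono hs _ h)

/-- The fractional isoperimetric inequality: balls minimize the fractional perimeter. -/
theorem gagliardo_ball_le (hN : 1 ≤ N) (hs : 0 < s) {A : Set (E N)} (hA : MeasurableSet A)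
    {r : ℝ} (hr : 0 < r) (hv : volume A = volume (Metric.ball (0 : E N) r)) :
    gagliardo s (ind (Metric.ball (0 : E N) r)) ≤ gagliardo s (ind A) := by
  have hb : MeasurableSet (Metric.ball (0 : E N) r) := Metric.isOpen_ball.measurableSet
  rw [gagliardo_ind hb, gagliardo_ind hA,
    pairMeasure_fracKernel_eq_iSup hs hb hb.compl disjoint_compl_right]
  gcongr
  refine iSup_le fun n => ?_
  exact (pairMeasure_ball_prod_compl_le hN (antitone_cutKernel hs n) (cutKernel_nonneg n)
    (norm_cutKernel_le hs n) (lintegral_cutKernel_ne_top hs n) hA hr hv).trans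
    (pairMeasure_cutKernel_le hs n hA hA.compl disjoint_compl_right)

theorem gagliardo_comp_add (u : E N → ℝ) (a : E N) :
    gagliardo s (fun x => u (x + a)) = gagliardo s u := by
  have h1 : gagliardo s (fun x => u (x + a)) = ∫⁻ x : E N, ∫⁻ y : E N,
      ENNReal.ofReal (|u (x + a) - u (y + a)| / ‖(x + a) - (y + a)‖ ^ ((N : ℝ) + s)) := by
    simp only [gagliardo, add_sub_add_right_eq_sub]
  rw [h1]
  rw [lintegral_add_right_eq_self (fun x : E N => ∫⁻ y : E N,
    ENNReal.ofReal (|u x - u (y + a)| / ‖x - (y + a)‖ ^ ((N : ℝ) + s))) a]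
  refine lintegral_congr fun x => ?_
  exact lintegral_add_right_eq_self (fun y : E N =>
    ENNReal.ofReal (|u x - u y| / ‖x - y‖ ^ ((N : ℝ) + s))) a

theorem lintegral_comp_inv_smul {r : ℝ} (hr : 0 < r) (f : E N → ℝ≥0∞) :
    ∫⁻ x, f (r⁻¹ • x) = ENNReal.ofReal (r ^ N) * ∫⁻ x, f x := by
  have h := Measure.map_addHaar_smul (volume : Measure (E N)) (inv_ne_zero hr.ne')
  have h2 := lintegral_map_equiv (μ := (volume : Measure (E N))) f
    (Homeomorph.smulOfNeZero r⁻¹ (inv_ne_zero hr.ne')).toMeasurableEquiv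
  have h3 : ⇑(Homeomorph.smulOfNeZero r⁻¹ (inv_ne_zero hr.ne')).toMeasurableEquiv =
    fun x : E N => r⁻¹ • x := rfl
  rw [h3, h, lintegral_smul_measure] at h2
  rw [← h2]
  simp [abs_of_pos (pow_pos hr N)]

/-- Two changes of variable contribute `r ^ N` each and the kernel contributes `r ^ (-(N + s))`. -/
theorem gagliardo_comp_inv_smul {r : ℝ} (hr : 0 < r) (u : E N → ℝ) :
    gagliardo s (fun x => u (r⁻¹ • x)) = ENNReal.ofReal (r ^ ((N : ℝ) - s)) * gagliardo s u := by
  have h1 : ∀ x y : E N, ENNReal.ofReal (|u (r⁻¹ • x) - u (r⁻¹ • y)| / ‖x - y‖ ^ ((N : ℝ) + s)) =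
      ENNReal.ofReal (r ^ (-((N : ℝ) + s))) * ENNReal.ofReal (|u (r⁻¹ • x) - u (r⁻¹ • y)| /
        ‖r⁻¹ • x - r⁻¹ • y‖ ^ ((N : ℝ) + s)) := by
    intro x y
    rw [← ENNReal.ofReal_mul (by positivity), ← smul_sub, norm_smul, norm_inv,
      Real.norm_of_nonneg hr.le, Real.mul_rpow (by positivity) (norm_nonneg _),
      Real.inv_rpow hr.le, Real.rpow_neg hr.le]
    congr 1
    have := (Real.rpow_pos_of_pos hr ((N : ℝ) + s)).ne'
    rw [← div_div, div_inv_eq_mul]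
    field_simp
  simp only [gagliardo, h1]
  simp_rw [lintegral_const_mul' _ _ ENNReal.ofReal_ne_top]
  rw [lintegral_comp_inv_smul hr (fun x : E N => ∫⁻ y : E N,
    ENNReal.ofReal (|u x - u (r⁻¹ • y)| / ‖x - r⁻¹ • y‖ ^ ((N : ℝ) + s)))]
  have h2 : ∀ x : E N, ∫⁻ y : E N,
      ENNReal.ofReal (|u x - u (r⁻¹ • y)| / ‖x - r⁻¹ • y‖ ^ ((N : ℝ) + s)) =
      ENNReal.ofReal (r ^ N) * ∫⁻ y : E N,
        ENNReal.ofReal (|u x - u y| / ‖x - y‖ ^ ((N : ℝ) + s)) := fun x =>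
    lintegral_comp_inv_smul hr (fun y : E N =>
      ENNReal.ofReal (|u x - u y| / ‖x - y‖ ^ ((N : ℝ) + s)))
  simp_rw [h2]
  rw [lintegral_const_mul' _ _ ENNReal.ofReal_ne_top, ← mul_assoc, ← mul_assoc,
    ← ENNReal.ofReal_mul (by positivity), ← ENNReal.ofReal_mul (by positivity),
    ← Real.rpow_natCast, ← Real.rpow_add hr, ← Real.rpow_add hr]
  congr 3
  ring

theorem critExp_inv : 1 / critExp N s = ((N : ℝ) - s) / N := by
  rw [critExp, one_div_div]

theorem one_lt_critExp (hN : 1 ≤ N) (hs0 : 0 < s) (hs1 : s < 1) : 1 < critExp N s := by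
  have : (1 : ℝ) ≤ N := by exact_mod_cast hN
  rw [critExp, one_lt_div (by linarith)]; linarith

/-- The isoperimetric ratio of the unit ball. -/
def ballConst (N : ℕ) (s : ℝ) : ℝ≥0∞ :=
  gagliardo s (ind (Metric.ball (0 : E N) 1)) /
    volume (Metric.ball (0 : E N) 1) ^ (1 / critExp N s)

/-- Translation and scaling reduce to the unit ball, since `r ^ (N - s)` is the power `1 / critExp N
s` of `r ^ N`. -/
theorem gagliardo_ball (hN : 1 ≤ N) (hs0 : 0 < s) (hs1 : s < 1) (a : E N) {r : ℝ} (hr : 0 < r) :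
    gagliardo s (ind (Metric.ball a r)) =
      ballConst N s * volume (Metric.ball a r) ^ (1 / critExp N s) := by
  have hb0 : volume (Metric.ball (0 : E N) 1) ≠ 0 := (Metric.measure_ball_pos _ _ one_pos).ne'
  have hbt : volume (Metric.ball (0 : E N) 1) ≠ ⊤ := measure_ball_lt_top.ne
  have hp := one_lt_critExp hN hs0 hs1
  have hN' : (1 : ℝ) ≤ N := by exact_mod_cast hN
  have e0 : ind (Metric.ball (0 : E N) r) = fun x => ind (Metric.ball (0 : E N) 1) (r⁻¹ • x) := by
    ext1 x
    have : x ∈ Metric.ball (0 : E N) r ↔ r⁻¹ • x ∈ Metric.ball (0 : E N) 1 := by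
      rw [mem_ball_zero_iff, mem_ball_zero_iff, norm_smul, norm_inv, Real.norm_of_nonneg hr.le,
        inv_mul_lt_iff₀ hr, mul_one]
    by_cases h : x ∈ Metric.ball (0 : E N) r
    · rw [ind, ind, Set.indicator_of_mem h, Set.indicator_of_mem (this.1 h)]
    · rw [ind, ind, Set.indicator_of_notMem h, Set.indicator_of_notMem (mt this.2 h)]
  have e1 : ind (Metric.ball a r) = fun x => ind (Metric.ball (0 : E N) r) (x + -a) := by
    ext1 x
    simp only [ind, Set.indicator, Metric.mem_ball, dist_eq_norm, sub_zero, sub_eq_add_neg x a]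
  rw [e1, gagliardo_comp_add (ind (Metric.ball (0 : E N) r)), e0, gagliardo_comp_inv_smul hr,
    Measure.addHaar_ball_center, volume_ball_zero hN hr.le,
    ENNReal.mul_rpow_of_nonneg _ _ (by positivity), ballConst,
    ENNReal.ofReal_rpow_of_nonneg (by positivity) (by positivity), mul_left_comm,
    ENNReal.div_mul_cancel (by simp [hb0, hbt]) (by
      refine ENNReal.rpow_ne_top_of_nonneg (by positivity) hbt),
    ← Real.rpow_natCast, ← Real.rpow_mul hr.le, critExp_inv]
  congr 3
  field_simp

/-- The fractional isoperimetric inequality in scale-invariant form. -/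
theorem ballConst_mul_le (hN : 1 ≤ N) (hs0 : 0 < s) (hs1 : s < 1) {A : Set (E N)}
    (hA : MeasurableSet A) (hAt : volume A ≠ ⊤) :
    ballConst N s * volume A ^ (1 / critExp N s) ≤ gagliardo s (ind A) := by
  have hp := one_lt_critExp hN hs0 hs1
  by_cases h0 : volume A = 0
  · rw [h0, ENNReal.zero_rpow_of_pos (by positivity), mul_zero]; exact zero_le
  obtain ⟨r, hr, hv⟩ := exists_volume_ball_eq hN h0 hAt
  rw [← hv, ← gagliardo_ball hN hs0 hs1 0 hr]
  exact gagliardo_ball_le hN hs0 hA hr hv.symm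

theorem ballConst_ne_zero (hN : 1 ≤ N) (hs0 : 0 < s) (hs1 : s < 1) : ballConst N s ≠ 0 := by
  have : Nonempty (Fin N) := ⟨⟨0, hN⟩⟩
  have hp := one_lt_critExp hN hs0 hs1
  have hbt : volume (Metric.ball (0 : E N) 1) ≠ ⊤ := measure_ball_lt_top.ne
  have hb : MeasurableSet (Metric.ball (0 : E N) 1) := Metric.isOpen_ball.measurableSet
  rw [ballConst, ENNReal.div_ne_zero]
  refine ⟨fun h => ?_, ENNReal.rpow_ne_top_of_nonneg (by positivity) hbt⟩
  rw [gagliardo_ind hb, mul_eq_zero, or_iff_right (by norm_num), pairMeasure,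
    withDensity_apply_eq_zero (measurable_pair_kernel (measurable_fracKernel N s))] at h
  rw [Set.inter_eq_right.2, Measure.prod_prod, mul_eq_zero] at h
  · rcases h with h | h
    · exact (Metric.measure_ball_pos volume (0 : E N) one_pos).ne' h
    -- The complement of the ball cannot be null: the whole space has infinite volume and the ball
    -- does not.
    · have h1 := measure_univ_of_isAddLeftInvariant (volume : Measure (E N))
      rw [← Set.union_compl_self (Metric.ball (0 : E N) 1)] at h1
      have h2 := measure_union_le (μ := volume) (Metric.ball (0 : E N) 1) (Metric.ball 0 1)ᶜ
      rw [h1, h, add_zero] at h2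
      exact hbt (top_le_iff.1 h2)
  · intro p hp
    have hne : p.1 ≠ p.2 := fun h => hp.2 (h ▸ hp.1)
    simp only [Set.mem_ofPred_eq, ne_eq, ENNReal.ofReal_eq_zero, not_le]
    exact Real.rpow_pos_of_pos (norm_pos_iff.2 (sub_ne_zero.2 hne)) _

end Perimeter

/-! ### Layer cake estimates and the sharp Sobolev inequality -/

section LayerCake

variable {α : Type*} [MeasurableSpace α] {μ : Measure α}

theorem lintegral_indicator_Iio_eq (a : ℝ) :
    ∫⁻ t in Set.Ioi (0 : ℝ), (Set.Iio a).indicator 1 t = ENNReal.ofReal a := by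
  rw [lintegral_indicator_one measurableSet_Iio, Measure.restrict_apply measurableSet_Iio,
    Set.Iio_inter_Ioi, Real.volume_Ioo, sub_zero]

/-- Minkowski's inequality for the layer cake decomposition, for functions of finite norm. -/
theorem lintegral_rpow_le_of_ne_top [SFinite μ] {p : ℝ} (hp : 1 < p) {f : α → ℝ}
    (hf : Measurable f) (hfin : ∫⁻ x, ENNReal.ofReal (f x) ^ p ∂μ ≠ ⊤) :
    (∫⁻ x, ENNReal.ofReal (f x) ^ p ∂μ) ^ (1 / p) ≤
      ∫⁻ t in Set.Ioi (0 : ℝ), μ {x | t < f x} ^ (1 / p) := by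
  set X := ∫⁻ x, ENNReal.ofReal (f x) ^ p ∂μ with hX
  set I := ∫⁻ t in Set.Ioi (0 : ℝ), μ {x | t < f x} ^ (1 / p) with hI
  have hp0 : 0 < p := by linarith
  by_cases hX0 : X = 0
  · rw [hX0, ENNReal.zero_rpow_of_pos (by positivity)]; exact zero_le
  have hq : p.HolderConjugate (p / (p - 1)) := Real.HolderConjugate.conjExponent hp
  set q := p / (p - 1) with hqdef
  have hU : Measurable fun x => ENNReal.ofReal (f x) := hf.ennreal_ofReal
  have hmeas : MeasurableSet {z : α × ℝ | z.2 < f z.1} :=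
    measurableSet_lt measurable_snd (hf.comp measurable_fst)
  have hm2 : Measurable (Function.uncurry fun (x : α) (t : ℝ) =>
      ENNReal.ofReal (f x) ^ (p - 1) * (Set.Iio (f x)).indicator 1 t) := by
    refine ((hU.comp measurable_fst).pow_const _).mul ?_
    have : (fun z : α × ℝ => (Set.Iio (f z.1)).indicator (1 : ℝ → ℝ≥0∞) z.2) =
        {z : α × ℝ | z.2 < f z.1}.indicator 1 := by
      ext1 z; simp [Set.indicator]
    rw [this]
    exact measurable_one.indicator hmeas
  -- One factor `f` of `f ^ p` is written as an integral over levels, and Hölder is applied at each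
  -- level. Dividing by `X ^ (1 / q)` at the end requires `X` finite and nonzero.
  have step1 : X = ∫⁻ t in Set.Ioi (0 : ℝ), ∫⁻ x,
      ENNReal.ofReal (f x) ^ (p - 1) * (Set.Iio (f x)).indicator 1 t ∂μ := by
    rw [← lintegral_lintegral_swap hm2.aemeasurable, hX]
    refine lintegral_congr fun x => ?_
    rw [lintegral_const_mul _ (measurable_one.indicator measurableSet_Iio),
      lintegral_indicator_Iio_eq]
    conv_lhs => rw [show p = (p - 1) + 1 by ring]
    rw [ENNReal.rpow_add_of_nonneg _ _ (by linarith) zero_le_one, ENNReal.rpow_one]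
  have step2 : ∀ t : ℝ, ∫⁻ x, ENNReal.ofReal (f x) ^ (p - 1) * (Set.Iio (f x)).indicator 1 t ∂μ ≤
      X ^ (1 / q) * μ {x | t < f x} ^ (1 / p) := by
    intro t
    have hA : MeasurableSet {x | t < f x} := measurableSet_lt measurable_const hf
    have h := ENNReal.lintegral_mul_le_Lp_mul_Lq μ hq.symm
      (f := fun x => ENNReal.ofReal (f x) ^ (p - 1)) (g := {x | t < f x}.indicator 1)
      (hU.pow_const _).aemeasurable (measurable_one.indicator hA).aemeasurable
    have e1 : ∀ x, (ENNReal.ofReal (f x) ^ (p - 1)) ^ q = ENNReal.ofReal (f x) ^ p := by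
      intro x
      rw [← ENNReal.rpow_mul, hqdef, mul_div_cancel₀ _ (by linarith)]
    have e2 : ∫⁻ x, ({x | t < f x}.indicator (1 : α → ℝ≥0∞) x) ^ p ∂μ = μ {x | t < f x} := by
      rw [← lintegral_indicator_one hA]
      refine lintegral_congr fun x => ?_
      by_cases hx : t < f x <;> simp [Set.indicator, hx, hp0]
    simp only [e1, e2] at h
    refine le_trans (le_of_eq (lintegral_congr fun x => ?_)) h
    simp [Set.indicator]
  have hXq0 : X ^ (1 / q) ≠ 0 := by
    simp [ENNReal.rpow_eq_zero_iff, hX0, hfin]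
  have hXqt : X ^ (1 / q) ≠ ⊤ := ENNReal.rpow_ne_top_of_nonneg hq.symm.one_div_nonneg hfin
  have step3 : X ≤ X ^ (1 / q) * I := by
    conv_lhs => rw [step1]
    rw [hI, ← lintegral_const_mul' _ _ hXqt]
    exact lintegral_mono fun t => step2 t
  have step4 : X ^ (1 / q) * X ^ (1 / p) ≤ X ^ (1 / q) * I := by
    rw [← ENNReal.rpow_add _ _ hX0 hfin]
    have : 1 / q + 1 / p = 1 := by
      have := hq.symm.inv_add_inv_eq_one
      simpa [one_div] using this
    rwa [this, ENNReal.rpow_one]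
  exact (ENNReal.mul_le_mul_iff_right hXq0 hXqt).1 step4

/-- Minkowski's inequality for the layer cake decomposition of an integrable function. -/
theorem lintegral_rpow_le_of_lintegral_ne_top [SFinite μ] {p : ℝ} (hp : 1 < p) {f : α → ℝ}
    (hf : Measurable f) (hfin : ∫⁻ x, ENNReal.ofReal (f x) ∂μ ≠ ⊤) :
    (∫⁻ x, ENNReal.ofReal (f x) ^ p ∂μ) ^ (1 / p) ≤
      ∫⁻ t in Set.Ioi (0 : ℝ), μ {x | t < f x} ^ (1 / p) := by
  have hp0 : 0 < p := by linarith
  -- Truncation at height `k` makes the `p`-th power integrable, because it is at most `k ^ (p - 1)`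
  -- times `f`.
  have hk : ∀ k : ℕ, (∫⁻ x, ENNReal.ofReal (min (f x) k) ^ p ∂μ) ^ (1 / p) ≤
      ∫⁻ t in Set.Ioi (0 : ℝ), μ {x | t < f x} ^ (1 / p) := by
    intro k
    refine (lintegral_rpow_le_of_ne_top hp (hf.min measurable_const) ?_).trans ?_
    · have hb : ∀ x, ENNReal.ofReal (min (f x) k) ^ p ≤ (k : ℝ≥0∞) ^ (p - 1) *
          ENNReal.ofReal (f x) := by
        intro x
        conv_lhs => rw [show p = (p - 1) + 1 by ring]
        rw [ENNReal.rpow_add_of_nonneg _ _ (by linarith) zero_le_one, ENNReal.rpow_one]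
        refine mul_le_mul' (ENNReal.rpow_le_rpow ?_ (by linarith))
          (ENNReal.ofReal_le_ofReal (min_le_left _ _))
        rw [← ENNReal.ofReal_natCast]
        exact ENNReal.ofReal_le_ofReal (min_le_right _ _)
      refine ne_top_of_le_ne_top ?_ (lintegral_mono hb)
      have hkt : (k : ℝ≥0∞) ^ (p - 1) ≠ ⊤ :=
        ENNReal.rpow_ne_top_of_nonneg (by linarith) (ENNReal.natCast_ne_top k)
      rw [lintegral_const_mul' _ _ hkt]
      exact ENNReal.mul_ne_top hkt hfin
    · refine lintegral_mono fun t => ENNReal.rpow_le_rpow (measure_mono fun x hx => ?_)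
        (by positivity)
      exact lt_of_lt_of_le (Set.mem_ofPred_eq ▸ hx) (min_le_left _ _)
  have hsup : ∫⁻ x, ENNReal.ofReal (f x) ^ p ∂μ =
      ⨆ k : ℕ, ∫⁻ x, ENNReal.ofReal (min (f x) k) ^ p ∂μ := by
    rw [← lintegral_iSup (fun k => (hf.min measurable_const).ennreal_ofReal.pow_const p)]
    · refine lintegral_congr fun x => le_antisymm ?_ (iSup_le fun k => ?_)
      · obtain ⟨k, hk⟩ := exists_nat_ge (f x)
        refine le_trans (le_of_eq ?_) (le_iSup _ k)
        rw [min_eq_left hk]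
      · exact ENNReal.rpow_le_rpow (ENNReal.ofReal_le_ofReal (min_le_left _ _)) hp0.le
    · intro m n hmn x
      exact ENNReal.rpow_le_rpow (ENNReal.ofReal_le_ofReal
        (min_le_min le_rfl (by exact_mod_cast hmn))) hp0.le
  rw [one_div, ENNReal.rpow_inv_le_iff hp0, hsup]
  refine iSup_le fun k => ?_
  rw [← ENNReal.rpow_inv_le_iff hp0, ← one_div]
  exact hk k

end LayerCake

/-! ### From sets to functions: coarea estimate, sharp Sobolev inequality, finiteness -/

section Sobolev

variable {N : ℕ} {s : ℝ}

instance (N : ℕ) (κ : ℝ → ℝ) : SFinite (pairMeasure N κ) := by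
  unfold pairMeasure; infer_instance

/-- The superlevel sets of `|u|` have total perimeter at most `[u]`. -/
theorem lintegral_gagliardo_superlevel_le {u : E N → ℝ} (hu : Measurable u) :
    ∫⁻ t in Set.Ioi (0 : ℝ), gagliardo s (ind {x | t < |u x|}) ≤ gagliardo s u := by
  have hA : ∀ t : ℝ, MeasurableSet {x | t < |u x|} := fun t =>
    measurableSet_lt measurable_const (by fun_prop)
  have e1 : ∀ t : ℝ, gagliardo s (ind {x | t < |u x|}) = ∫⁻ p,
      ‖ind {x | t < |u x|} p.1 - ind {x | t < |u x|} p.2‖ₑ ∂(pairMeasure N (fracKernel N s)) :=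
    fun t => gagliardo_eq_lintegral_pair (measurable_const.indicator (hA t))
  simp_rw [e1]
  have hm : ∀ g : ℝ × (E N × E N) → E N, Measurable g →
      Measurable fun z : ℝ × (E N × E N) => ind {x | z.1 < |u x|} (g z) := by
    intro g hg
    have : (fun z : ℝ × (E N × E N) => ind {x | z.1 < |u x|} (g z)) =
        {z : ℝ × (E N × E N) | z.1 < |u (g z)|}.indicator fun _ => (1 : ℝ) := by
      ext1 z; simp [Set.indicator]
    rw [this]
    exact measurable_const.indicator (measurableSet_lt measurable_fst (by fun_prop))
  rw [lintegral_lintegral_swap, gagliardo_eq_lintegral_pair hu]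
  · refine lintegral_mono fun p => ?_
    -- A level `t` separates the two points exactly when it lies in the half-open interval between
    -- the values of `|u|`, whose length is at most `|u x - u y|`.
    have key : ∀ a b : ℝ, a ≤ b → ∫⁻ t in Set.Ioi (0 : ℝ),
        (Set.Ico a b).indicator (1 : ℝ → ℝ≥0∞) t ≤ ENNReal.ofReal (b - a) := by
      intro a b hab
      rw [lintegral_indicator_one measurableSet_Ico, ← Real.volume_Ico]
      exact Measure.restrict_apply_le _ _
    have hle : ‖|u p.1| - |u p.2|‖ₑ ≤ ‖u p.1 - u p.2‖ₑ := by
      rw [Real.enorm_eq_ofReal_abs, Real.enorm_eq_ofReal_abs]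
      exact ENNReal.ofReal_le_ofReal (abs_abs_sub_abs_le_abs_sub _ _)
    refine le_trans ?_ hle
    rw [Real.enorm_eq_ofReal_abs]
    rcases le_total |u p.1| |u p.2| with h | h
    · rw [abs_sub_comm, abs_of_nonneg (sub_nonneg.2 h)]
      refine le_trans (lintegral_mono fun t => ?_) (key _ _ h)
      by_cases h1 : t < |u p.1| <;> by_cases h2 : t < |u p.2|
      · simp [Set.indicator, h1, h2]
      · exact absurd (h1.trans_le h) h2
      · simp [Set.indicator, h1, h2, not_lt.1 h1]
      · simp [Set.indicator, h1, h2]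
    · rw [abs_of_nonneg (sub_nonneg.2 h)]
      refine le_trans (lintegral_mono fun t => ?_) (key _ _ h)
      by_cases h1 : t < |u p.1| <;> by_cases h2 : t < |u p.2|
      · simp [Set.indicator, h1, h2]
      · simp [Set.indicator, h1, h2, not_lt.1 h2]
      · exact absurd (h2.trans_le h) h1
      · simp [Set.indicator, h1, h2]
  · exact ((hm _ (by fun_prop)).sub (hm _ (by fun_prop))).enorm.aemeasurable

theorem eLpNorm_eq_lintegral_abs {p : ℝ} (hp : 0 < p) (u : E N → ℝ) :
    eLpNorm u (ENNReal.ofReal p) volume = (∫⁻ x, ENNReal.ofReal |u x| ^ p) ^ (1 / p) := by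
  rw [eLpNorm_eq_lintegral_rpow_enorm_toReal (by simpa using hp) ENNReal.ofReal_ne_top,
    ENNReal.toReal_ofReal hp.le]
  simp only [Real.enorm_eq_ofReal_abs]

theorem superlevel_measure_ne_top {p : ℝ≥0∞} (hp0 : p ≠ 0) (hpt : p ≠ ⊤) {u : E N → ℝ}
    (hu : MemLp u p volume) {t : ℝ} (ht : 0 < t) : volume {x | t < |u x|} ≠ ⊤ := by
  have h := hu.meas_ge_lt_top' hp0 hpt (ε := ENNReal.ofReal t) (by simpa using ht)
  refine ne_top_of_le_ne_top h.ne (measure_mono fun x hx => ?_)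
  simp only [Set.mem_ofPred_eq] at hx ⊢
  rw [← enorm_eq_nnnorm, Real.enorm_eq_ofReal_abs]
  exact ENNReal.ofReal_le_ofReal hx.le

/-- Minkowski over levels, the isoperimetric inequality at each level, then the coarea estimate. The
alternative in the hypothesis serves `W` and `D`; either side gives finite superlevel volumes and a
version of Minkowski. -/
theorem ballConst_mul_eLpNorm_le_of_measurable (hN : 1 ≤ N) (hs0 : 0 < s) (hs1 : s < 1)
    {u : E N → ℝ} (hm : Measurable u)
    (hu : MemLp u 1 volume ∨ MemLp u (ENNReal.ofReal (critExp N s)) volume) :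
    ballConst N s * eLpNorm u (ENNReal.ofReal (critExp N s)) volume ≤ gagliardo s u := by
  have hp := one_lt_critExp hN hs0 hs1
  have hp0 : 0 < critExp N s := by linarith
  have h1 : eLpNorm u (ENNReal.ofReal (critExp N s)) volume ≤
      ∫⁻ t in Set.Ioi (0 : ℝ), volume {x | t < |u x|} ^ (1 / critExp N s) := by
    have hma : Measurable fun x => |u x| := by fun_prop
    rw [eLpNorm_eq_lintegral_abs hp0]
    rcases hu with hu | hu
    · refine lintegral_rpow_le_of_lintegral_ne_top hp hma ?_
      have := hu.eLpNorm_lt_top.ne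
      rw [eLpNorm_one_eq_lintegral_enorm] at this
      simpa only [Real.enorm_eq_ofReal_abs] using this
    · refine lintegral_rpow_le_of_ne_top hp hma fun h => ?_
      have := hu.eLpNorm_lt_top.ne
      rw [eLpNorm_eq_lintegral_abs hp0, h, ENNReal.top_rpow_of_pos (by positivity)] at this
      exact this rfl
  have hfin : ∀ t : ℝ, 0 < t → volume {x | t < |u x|} ≠ ⊤ := by
    intro t ht
    rcases hu with hu | hu
    · exact superlevel_measure_ne_top one_ne_zero ENNReal.one_ne_top hu ht
    · exact superlevel_measure_ne_top (by simpa using hp0) ENNReal.ofReal_ne_top hu ht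
  have hanti : Antitone fun t : ℝ => volume {x | t < |u x|} ^ (1 / critExp N s) := fun a b hab =>
    ENNReal.rpow_le_rpow (measure_mono fun x (hx : b < |u x|) => hab.trans_lt hx) (by positivity)
  calc ballConst N s * eLpNorm u (ENNReal.ofReal (critExp N s)) volume
      ≤ ballConst N s *
        ∫⁻ t in Set.Ioi (0 : ℝ), volume {x | t < |u x|} ^ (1 / critExp N s) := by gcongr
    _ = ∫⁻ t in Set.Ioi (0 : ℝ), ballConst N s * volume {x | t < |u x|} ^ (1 / critExp N s) :=
        (lintegral_const_mul _ hanti.measurable).symm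
    _ ≤ ∫⁻ t in Set.Ioi (0 : ℝ), gagliardo s (ind {x | t < |u x|}) := by
        refine setLIntegral_mono' measurableSet_Ioi fun t ht => ?_
        exact ballConst_mul_le hN hs0 hs1 (measurableSet_lt measurable_const (by fun_prop))
          (hfin t ht)
    _ ≤ gagliardo s u := lintegral_gagliardo_superlevel_le hm

/-- The sharp fractional Sobolev inequality. -/
theorem ballConst_mul_eLpNorm_le (hN : 1 ≤ N) (hs0 : 0 < s) (hs1 : s < 1) {u : E N → ℝ}
    (hu : MemLp u 1 volume ∨ MemLp u (ENNReal.ofReal (critExp N s)) volume) :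
    ballConst N s * eLpNorm u (ENNReal.ofReal (critExp N s)) volume ≤ gagliardo s u := by
  have hm : AEStronglyMeasurable u volume := hu.elim (·.1) (·.1)
  have hae := hm.ae_eq_mk
  rw [eLpNorm_congr_ae hae, gagliardo_congr hae]
  exact ballConst_mul_eLpNorm_le_of_measurable hN hs0 hs1 hm.stronglyMeasurable_mk.measurable
    (hu.imp (·.ae_eq hae) (·.ae_eq hae))

/-- In polar coordinates the integrand is a multiple of `t ^ (-s)` near 0 and of `t ^ (-1 - s)` at
infinity; this uses `s < 1` and `0 < s`. -/
theorem lintegral_min_fracKernel_ne_top (hN : 1 ≤ N) (hs0 : 0 < s) (hs1 : s < 1) :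
    ∫⁻ z : E N, ENNReal.ofReal (min ‖z‖ 1 * fracKernel N s ‖z‖) ≠ ⊤ := by
  have : Nonempty (Fin N) := ⟨⟨0, hN⟩⟩
  have h : Integrable (fun z : E N => (fun t : ℝ => min t 1 * fracKernel N s t) ‖z‖) := by
    rw [integrable_fun_norm_addHaar (volume : Measure (E N))
      (f := fun t : ℝ => min t 1 * fracKernel N s t)]
    have hpow : ∀ t : ℝ, 0 < t → t ^ (Module.finrank ℝ (E N) - 1) * fracKernel N s t =
        t ^ (-1 - s) := by
      intro t ht
      rw [fracKernel, ← Real.rpow_natCast, ← Real.rpow_add ht, finrank_euclideanSpace_fin,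
        Nat.cast_sub hN]
      congr 1; push_cast; ring
    have i1 : IntegrableOn (fun t : ℝ => t ^ (-s)) (Set.Ioc 0 1) := by
      rw [← intervalIntegrable_iff_integrableOn_Ioc_of_le zero_le_one]
      exact intervalIntegral.intervalIntegrable_rpow' (by linarith)
    have i2 : IntegrableOn (fun t : ℝ => t ^ (-1 - s)) (Set.Ioi 1) :=
      integrableOn_Ioi_rpow_of_lt (by linarith) one_pos
    rw [← Set.Ioc_union_Ioi_eq_Ioi zero_le_one]
    refine IntegrableOn.union (i1.congr_fun (fun t ht => ?_) measurableSet_Ioc)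
      (i2.congr_fun (fun t ht => ?_) measurableSet_Ioi)
    · simp only [smul_eq_mul]
      rw [min_eq_left ht.2, mul_left_comm, hpow t ht.1, ← Real.rpow_one_add' ht.1.le (by linarith)]
      congr 1; ring
    · have ht0 : (0 : ℝ) < t := one_pos.trans ht
      simp only [smul_eq_mul]
      rw [min_eq_right (le_of_lt ht), one_mul, hpow t ht0]
  exact h.lintegral_lt_top.ne

/-- Each of the two indicator terms is integrated first in the variable it does not involve, which
gives the volume of `B` times the kernel integral. -/
theorem gagliardo_ne_top_of_abs_sub_le (hN : 1 ≤ N) (hs0 : 0 < s) (hs1 : s < 1)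
    {B : Set (E N)} (hB : MeasurableSet B) (hBt : volume B ≠ ⊤) {u : E N → ℝ} {L : ℝ}
    (hu : ∀ x y, |u x - u y| ≤ L * ((ind B x + ind B y) * min ‖x - y‖ 1)) :
    gagliardo s u ≠ ⊤ := by
  set I := ∫⁻ z : E N, ENNReal.ofReal (min ‖z‖ 1 * fracKernel N s ‖z‖) with hI
  have hIt : I ≠ ⊤ := lintegral_min_fracKernel_ne_top hN hs0 hs1
  have hk : Measurable fun z : E N => ENNReal.ofReal (min ‖z‖ 1 * fracKernel N s ‖z‖) := by
    have := measurable_fracKernel N s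
    fun_prop
  have hk2 : Measurable fun p : E N × E N =>
      ENNReal.ofReal (min ‖p.1 - p.2‖ 1 * fracKernel N s ‖p.1 - p.2‖) :=
    hk.comp (measurable_fst.sub measurable_snd)
  have hBi : Measurable (B.indicator (1 : E N → ℝ≥0∞)) := measurable_one.indicator hB
  have hm1 : Measurable fun p : E N × E N => B.indicator 1 p.1 *
      ENNReal.ofReal (min ‖p.1 - p.2‖ 1 * fracKernel N s ‖p.1 - p.2‖) :=
    (hBi.comp measurable_fst).mul hk2
  have hm2 : Measurable fun p : E N × E N => B.indicator 1 p.2 *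
      ENNReal.ofReal (min ‖p.1 - p.2‖ 1 * fracKernel N s ‖p.1 - p.2‖) :=
    (hBi.comp measurable_snd).mul hk2
  have hle : ∀ x y : E N, ENNReal.ofReal (|u x - u y| / ‖x - y‖ ^ ((N : ℝ) + s)) ≤
      ENNReal.ofReal L *
      (B.indicator 1 x * ENNReal.ofReal (min ‖x - y‖ 1 * fracKernel N s ‖x - y‖) +
      B.indicator 1 y * ENNReal.ofReal (min ‖x - y‖ 1 * fracKernel N s ‖x - y‖)) := by
    intro x y
    have hnn : ∀ z : E N, 0 ≤ ind B z := fun z => Set.indicator_nonneg (fun _ _ => zero_le_one) z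
    have e : (B.indicator 1 x + B.indicator 1 y : ℝ≥0∞) =
        ENNReal.ofReal (ind B x + ind B y) := by
      rw [ENNReal.ofReal_add (hnn x) (hnn y)]
      by_cases hx : x ∈ B <;> by_cases hy : y ∈ B <;> simp [Set.indicator, hx, hy]
    have h0 : 0 ≤ (ind B x + ind B y) * (min ‖x - y‖ 1 * fracKernel N s ‖x - y‖) :=
      mul_nonneg (add_nonneg (hnn x) (hnn y)) (mul_nonneg (le_min (norm_nonneg _) zero_le_one)
        (fracKernel_nonneg (norm_nonneg _)))
    rw [← add_mul, e, ← ENNReal.ofReal_mul (add_nonneg (hnn x) (hnn y)),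
      ← ENNReal.ofReal_mul' h0, fracKernel, Real.rpow_neg (norm_nonneg _), ← mul_assoc,
      ← mul_assoc, ← div_eq_mul_inv, mul_assoc]
    gcongr
    exact hu x y
  have htot : ∫⁻ p : E N × E N, B.indicator 1 p.1 *
      ENNReal.ofReal (min ‖p.1 - p.2‖ 1 * fracKernel N s ‖p.1 - p.2‖) ∂(volume.prod volume) =
      volume B * I := by
    rw [lintegral_prod _ hm1.aemeasurable]
    have : ∀ x : E N, ∫⁻ y : E N, B.indicator 1 x *
        ENNReal.ofReal (min ‖x - y‖ 1 * fracKernel N s ‖x - y‖) = B.indicator 1 x * I := by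
      intro x
      have hkx : Measurable fun y : E N =>
          ENNReal.ofReal (min ‖x - y‖ 1 * fracKernel N s ‖x - y‖) :=
        hk.comp (measurable_const.sub measurable_id)
      rw [lintegral_const_mul _ hkx]
      congr 1
      exact lintegral_sub_left_eq_self
        (fun z : E N => ENNReal.ofReal (min ‖z‖ 1 * fracKernel N s ‖z‖)) x
    simp_rw [this]
    rw [lintegral_mul_const _ hBi, lintegral_indicator_one hB]
  have htot2 : ∫⁻ p : E N × E N, B.indicator 1 p.2 *
      ENNReal.ofReal (min ‖p.1 - p.2‖ 1 * fracKernel N s ‖p.1 - p.2‖) ∂(volume.prod volume) =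
      volume B * I := by
    rw [← htot, ← lintegral_prod_swap]
    simp only [Prod.fst_swap, Prod.snd_swap, norm_sub_rev]
  have hfin : gagliardo s u ≤ ENNReal.ofReal L * (volume B * I + volume B * I) := by
    conv_rhs => rw [← htot]
    nth_rw 2 [htot]
    rw [← htot2, ← lintegral_add_left hm1, ← lintegral_const_mul _ (by exact hm1.add hm2),
      lintegral_prod _ (by exact ((hm1.add hm2).const_mul _).aemeasurable)]
    exact lintegral_mono fun x => lintegral_mono fun y => hle x y
  refine ne_top_of_le_ne_top ?_ hfin
  have : volume B * I ≠ ⊤ := ENNReal.mul_ne_top hBt hIt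
  exact ENNReal.mul_ne_top ENNReal.ofReal_ne_top (ENNReal.add_ne_top.2 ⟨this, this⟩)

/-- Test functions have finite Gagliardo seminorm. -/
theorem IsTest.gagliardo_ne_top (hN : 1 ≤ N) (hs0 : 0 < s) (hs1 : s < 1) {u : E N → ℝ}
    (hu : IsTest u) : gagliardo s u ≠ ⊤ := by
  obtain ⟨K, hK⟩ := ContDiff.lipschitzWith_of_hasCompactSupport hu.2 hu.1 (by simp)
  obtain ⟨M, hM⟩ := hu.2.exists_bound_of_continuous hu.1.continuous
  have hM0 : 0 ≤ M := (norm_nonneg _).trans (hM 0)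
  refine gagliardo_ne_top_of_abs_sub_le hN hs0 hs1 (B := tsupport u) (L := K + 2 * M)
    (isClosed_tsupport u).measurableSet hu.2.isCompact.measure_lt_top.ne fun x y => ?_
  have h1 : |u x - u y| ≤ K * ‖x - y‖ := by
    simpa [Real.dist_eq, dist_eq_norm] using hK.dist_le_mul x y
  have h2 : |u x - u y| ≤ 2 * M := by
    have hx := abs_le.1 (hM x)
    have hy := abs_le.1 (hM y)
    rw [abs_le]; constructor <;> linarith
  have h3 : |u x - u y| ≤ (K + 2 * M) * min ‖x - y‖ 1 := by
    have hK0 : (0 : ℝ) ≤ K := K.2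
    rcases le_total ‖x - y‖ 1 with h | h
    · rw [min_eq_left h]; nlinarith [norm_nonneg (x - y)]
    · rw [min_eq_right h]; nlinarith [norm_nonneg (x - y)]
  have h4 : 0 ≤ (K + 2 * M) * min ‖x - y‖ 1 := (abs_nonneg _).trans h3
  by_cases hx : x ∈ tsupport u <;> by_cases hy : y ∈ tsupport u
  · rw [ind, Set.indicator_of_mem hx, Set.indicator_of_mem hy]; linarith
  · rw [ind, Set.indicator_of_mem hx, Set.indicator_of_notMem hy]; linarith
  · rw [ind, Set.indicator_of_notMem hx, Set.indicator_of_mem hy]; linarith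
  · rw [ind, Set.indicator_of_notMem hx, Set.indicator_of_notMem hy,
      image_eq_zero_of_notMem_tsupport hx, image_eq_zero_of_notMem_tsupport hy]
    simp

/-- No perimeter is computed: an infinite constant in the Sobolev inequality would give a smooth
bump an infinite seminorm. -/
theorem ballConst_ne_top (hN : 1 ≤ N) (hs0 : 0 < s) (hs1 : s < 1) : ballConst N s ≠ ⊤ := by
  intro hc
  have hp := one_lt_critExp hN hs0 hs1
  let b : ContDiffBump (0 : E N) := ⟨1, 2, one_pos, one_lt_two⟩
  have hb : IsTest (b : E N → ℝ) := ⟨b.contDiff, b.hasCompactSupport⟩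
  have h := ballConst_mul_eLpNorm_le hN hs0 hs1 (u := b)
    (Or.inl (b.continuous.memLp_of_hasCompactSupport b.hasCompactSupport))
  have h0 : eLpNorm (b : E N → ℝ) (ENNReal.ofReal (critExp N s)) volume ≠ 0 := by
    rw [Ne, eLpNorm_eq_zero_iff b.continuous.aestronglyMeasurable (by
      simpa using (by linarith : 0 < critExp N s))]
    intro hae
    have h1 : b (0 : E N) = 0 :=
      congrFun (b.continuous.ae_eq_iff_eq volume continuous_const |>.1 hae) 0
    rw [b.one_of_mem_closedBall (by simp [b])] at h1
    exact one_ne_zero h1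
  rw [hc, ENNReal.top_mul h0, top_le_iff] at h
  exact hb.gagliardo_ne_top hN hs0 hs1 h

end Sobolev

/-! ### Density of test functions and the value of the isoperimetric constant -/

/-- Scheffé's lemma: almost everywhere convergence without gain of mass is convergence in `L¹`. -/
theorem tendsto_lintegral_enorm_sub {α : Type*} [MeasurableSpace α] {μ : Measure α}
    {f : ℕ → α → ℝ} {g : α → ℝ} (hf : ∀ n, Measurable (f n)) (hg : Measurable g)
    (hle : ∀ n, ∫⁻ x, ‖f n x‖ₑ ∂μ ≤ ∫⁻ x, ‖g x‖ₑ ∂μ) (hfin : ∫⁻ x, ‖g x‖ₑ ∂μ ≠ ⊤)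
    (hlim : ∀ᵐ x ∂μ, Tendsto (fun n => f n x) atTop (𝓝 (g x))) :
    Tendsto (fun n => ∫⁻ x, ‖f n x - g x‖ₑ ∂μ) atTop (𝓝 0) := by
  set A := ∫⁻ x, ‖g x‖ₑ ∂μ with hA
  -- The defect in the triangle inequality is nonnegative and tends to `2 * |g|`, so Fatou shows
  -- that it absorbs all of the available mass.
  let h : ℕ → α → ℝ≥0∞ := fun n x => ENNReal.ofReal (|f n x| + |g x| - |f n x - g x|)
  have hh : ∀ n, Measurable (h n) := fun n => by
    have := hf n
    fun_prop
  have hsum : ∀ n, ∫⁻ x, h n x ∂μ + ∫⁻ x, ‖f n x - g x‖ₑ ∂μ ≤ A + A := by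
    intro n
    have e : ∀ x, h n x + ‖f n x - g x‖ₑ = ‖f n x‖ₑ + ‖g x‖ₑ := by
      intro x
      simp only [h, Real.enorm_eq_ofReal_abs]
      rw [← ENNReal.ofReal_add (sub_nonneg.2 (abs_sub _ _)) (abs_nonneg _), sub_add_cancel,
        ENNReal.ofReal_add (abs_nonneg _) (abs_nonneg _)]
    rw [← lintegral_add_left (hh n)]
    simp_rw [e]
    rw [lintegral_add_left (hf n).enorm]
    gcongr
    exact hle n
  have hFatou : A + A ≤ liminf (fun n => ∫⁻ x, h n x ∂μ) atTop := by
    refine le_trans (le_of_eq ?_) (lintegral_liminf_le hh)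
    rw [hA, ← lintegral_add_left hg.enorm]
    refine lintegral_congr_ae ?_
    filter_upwards [hlim] with x hx
    have h1 : Tendsto (fun n => h n x) atTop
        (𝓝 (ENNReal.ofReal (|g x| + |g x| - |g x - g x|))) :=
      (ENNReal.continuous_ofReal.tendsto _).comp
        (((hx.abs).add_const _).sub ((hx.sub_const _).abs))
    rw [h1.liminf_eq, sub_self, abs_zero, sub_zero, ENNReal.ofReal_add (abs_nonneg _)
      (abs_nonneg _), Real.enorm_eq_ofReal_abs]
  rw [ENNReal.tendsto_nhds_zero]
  intro ε hε
  by_cases hA0 : A = 0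
  · refine Eventually.of_forall fun n => ?_
    have := (le_add_self.trans (hsum n))
    rw [hA0, add_zero] at this
    exact this.trans zero_le
  have hAA : A + A ≠ ⊤ := ENNReal.add_ne_top.2 ⟨hfin, hfin⟩
  have hlt : A + A - ε < liminf (fun n => ∫⁻ x, h n x ∂μ) atTop :=
    (ENNReal.sub_lt_self hAA (by simpa using hA0) hε.ne').trans_le hFatou
  filter_upwards [eventually_lt_of_lt_liminf hlt] with n hn
  have h1 : ∫⁻ x, h n x ∂μ ≠ ⊤ := ne_top_of_le_ne_top hAA (le_self_add.trans (hsum n))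
  have h2 : A + A ≤ ∫⁻ x, h n x ∂μ + ε := by
    rw [← tsub_le_iff_right]; exact hn.le
  exact (ENNReal.add_le_add_iff_left h1).1 ((hsum n).trans h2)

/-! ### Approximation by mollification and test functions -/

section Mollify

variable {N : ℕ} {s : ℝ} {u : E N → ℝ}

/-- The convolution of `u` with a normalized bump function. -/
def mollify (b : ContDiffBump (0 : E N)) (u : E N → ℝ) : E N → ℝ :=
  convolution (b.normed volume) u (ContinuousLinearMap.lsmul ℝ ℝ) volume

theorem lintegral_normed_enorm (b : ContDiffBump (0 : E N)) :
    ∫⁻ t, ‖b.normed volume t‖ₑ = 1 := by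
  rw [← ofReal_integral_norm_eq_lintegral_enorm b.integrable_normed]
  simp_rw [Real.norm_of_nonneg (b.nonneg_normed _)]
  rw [b.integral_normed, ENNReal.ofReal_one]

theorem isTest_mollify (b : ContDiffBump (0 : E N)) (hu : Integrable u)
    (hcs : HasCompactSupport u) : IsTest (mollify b u) := by
  refine ⟨?_, b.hasCompactSupport_normed.convolution _ hcs⟩
  exact b.hasCompactSupport_normed.contDiff_convolution_left (n := ⊤)
    (ContinuousLinearMap.lsmul ℝ ℝ) b.contDiff_normed hu.locallyIntegrable

theorem integrable_mollify_integrand (b : ContDiffBump (0 : E N)) (hu : Integrable u) (x : E N) :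
    Integrable fun t => b.normed volume t • u (x - t) :=
  (b.hasCompactSupport_normed.convolutionExists_left (ContinuousLinearMap.lsmul ℝ ℝ)
    b.continuous_normed hu.locallyIntegrable) x

theorem mollify_apply (b : ContDiffBump (0 : E N)) (x : E N) :
    mollify b u x = ∫ t, b.normed volume t • u (x - t) := rfl

/-- A mollification is an average of translates, and the seminorm is convex and translation
invariant. This is the absence of mass gain that Scheffé's lemma needs on pairs. -/
theorem gagliardo_mollify_le (b : ContDiffBump (0 : E N)) (hm : Measurable u)
    (hu : Integrable u) (hcs : HasCompactSupport u) :
    gagliardo s (mollify b u) ≤ gagliardo s u := by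
  have hb : Measurable (b.normed (volume : Measure (E N))) := b.continuous_normed.measurable
  have hφ : Measurable (mollify b u) := (isTest_mollify b hu hcs).1.continuous.measurable
  rw [gagliardo_eq_lintegral_pair hφ]
  have h1 : ∀ p : E N × E N, ‖mollify b u p.1 - mollify b u p.2‖ₑ ≤
      ∫⁻ t, ‖b.normed volume t‖ₑ * ‖u (p.1 - t) - u (p.2 - t)‖ₑ := by
    intro p
    rw [mollify_apply, mollify_apply, ← integral_sub (integrable_mollify_integrand b hu _)
      (integrable_mollify_integrand b hu _)]
    refine (enorm_integral_le_lintegral_enorm _).trans (le_of_eq (lintegral_congr fun t => ?_))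
    rw [← smul_sub, enorm_smul]
  refine (lintegral_mono h1).trans ?_
  rw [lintegral_lintegral_swap (by
    refine Measurable.aemeasurable ?_
    simp only [Function.uncurry_def]
    fun_prop)]
  have h2 : ∀ t : E N, ∫⁻ p, ‖b.normed volume t‖ₑ * ‖u (p.1 - t) - u (p.2 - t)‖ₑ
      ∂(pairMeasure N (fracKernel N s)) = ‖b.normed volume t‖ₑ * gagliardo s u := by
    intro t
    rw [lintegral_const_mul' _ _ enorm_ne_top]
    have hmt : Measurable fun x => u (x + -t) := by fun_prop
    rw [← gagliardo_comp_add u (-t), gagliardo_eq_lintegral_pair hmt]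
    simp only [sub_eq_add_neg]
  simp_rw [h2]
  rw [lintegral_mul_const _ hb.enorm, lintegral_normed_enorm, one_mul]

theorem lintegral_mollify_le (b : ContDiffBump (0 : E N)) (hm : Measurable u) :
    ∫⁻ x, ‖mollify b u x‖ₑ ≤ ∫⁻ x, ‖u x‖ₑ := by
  have hb : Measurable (b.normed (volume : Measure (E N))) := b.continuous_normed.measurable
  have h1 : ∀ x : E N, ‖mollify b u x‖ₑ ≤ ∫⁻ t, ‖b.normed volume t‖ₑ * ‖u (x - t)‖ₑ := by
    intro x
    rw [mollify_apply]
    refine (enorm_integral_le_lintegral_enorm _).trans (le_of_eq (lintegral_congr fun t => ?_))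
    rw [enorm_smul]
  refine (lintegral_mono h1).trans ?_
  rw [lintegral_lintegral_swap (by
    refine Measurable.aemeasurable ?_
    simp only [Function.uncurry_def]
    fun_prop)]
  have h2 : ∀ t : E N, ∫⁻ x, ‖b.normed volume t‖ₑ * ‖u (x - t)‖ₑ =
      ‖b.normed volume t‖ₑ * ∫⁻ x, ‖u x‖ₑ := by
    intro t
    rw [lintegral_const_mul' _ _ enorm_ne_top, lintegral_sub_right_eq_self (fun x => ‖u x‖ₑ) t]
  simp_rw [h2]
  rw [lintegral_mul_const _ hb.enorm, lintegral_normed_enorm, one_mul]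

/-- Compactly supported integrable functions of finite seminorm are limits of test functions. -/
theorem exists_isTest_tendsto (hm : Measurable u) (hu : Integrable u) (hcs : HasCompactSupport u)
    (hfin : gagliardo s u ≠ ⊤) :
    ∃ φ : ℕ → E N → ℝ, (∀ n, IsTest (φ n)) ∧
      Tendsto (fun n => gagliardo s (φ n - u)) atTop (𝓝 0) ∧
      Tendsto (fun n => eLpNorm (φ n - u) 1 volume) atTop (𝓝 0) := by
  -- The fixed ratio 2 between outer and inner radius is the bound `K` required for almost
  -- everywhere convergence.
  let b : ℕ → ContDiffBump (0 : E N) := fun n =>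
    ⟨1 / ((n : ℝ) + 1), 2 * (1 / ((n : ℝ) + 1)), by positivity, by
      have : 0 < 1 / ((n : ℝ) + 1) := by positivity
      linarith⟩
  have hb : Tendsto (fun n => (b n).rOut) atTop (𝓝 0) := by
    have := (tendsto_one_div_add_atTop_nhds_zero_nat (𝕜 := ℝ)).const_mul 2
    rwa [mul_zero] at this
  have hae : ∀ᵐ x, Tendsto (fun n => mollify (b n) u x) atTop (𝓝 (u x)) :=
    ContDiffBump.ae_convolution_tendsto_right_of_locallyIntegrable hb (K := 2)
      (Eventually.of_forall fun n => le_rfl) hu.locallyIntegrable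
  have hφ : ∀ n, Measurable (mollify (b n) u) := fun n =>
    (isTest_mollify (b n) hu hcs).1.continuous.measurable
  refine ⟨fun n => mollify (b n) u, fun n => isTest_mollify (b n) hu hcs, ?_, ?_⟩
  · have hac : pairMeasure N (fracKernel N s) ≪ volume.prod volume :=
      withDensity_absolutelyContinuous _ _
    have hae1 := Measure.quasiMeasurePreserving_fst (μ := (volume : Measure (E N)))
      (ν := (volume : Measure (E N))) |>.ae hae
    have hae2 := Measure.quasiMeasurePreserving_snd (μ := (volume : Measure (E N)))
      (ν := (volume : Measure (E N))) |>.ae hae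
    have hlim : ∀ᵐ p ∂(pairMeasure N (fracKernel N s)),
        Tendsto (fun n => mollify (b n) u p.1 - mollify (b n) u p.2) atTop
          (𝓝 (u p.1 - u p.2)) := by
      refine hac.ae_le ?_
      filter_upwards [hae1, hae2] with p h1 h2 using h1.sub h2
    have h := tendsto_lintegral_enorm_sub (μ := pairMeasure N (fracKernel N s))
      (f := fun n p => mollify (b n) u p.1 - mollify (b n) u p.2) (g := fun p => u p.1 - u p.2)
      (fun n => by have := hφ n; fun_prop) (by fun_prop) (fun n => by
        rw [← gagliardo_eq_lintegral_pair hm, ← gagliardo_eq_lintegral_pair (hφ n)]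
        exact gagliardo_mollify_le (b n) hm hu hcs)
      (by rwa [← gagliardo_eq_lintegral_pair hm]) hlim
    refine h.congr fun n => ?_
    rw [gagliardo_eq_lintegral_pair ((hφ n).sub hm)]
    refine lintegral_congr fun p => ?_
    congr 1
    simp only [Pi.sub_apply]
    ring
  · have h := tendsto_lintegral_enorm_sub hφ hm (fun n => lintegral_mollify_le (b n) hm)
      hu.2.ne hae
    refine h.congr fun n => ?_
    rw [eLpNorm_one_eq_lintegral_enorm]
    rfl

theorem memLp_ind {A : Set (E N)} (hA : MeasurableSet A) (hAt : volume A ≠ ⊤) (p : ℝ≥0∞) :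
    MemLp (ind A) p volume := memLp_indicator_const p hA 1 (Or.inr hAt)

theorem eLpNorm_ind {A : Set (E N)} (hA : MeasurableSet A) {p : ℝ} (hp : 0 < p) :
    eLpNorm (ind A) (ENNReal.ofReal p) volume = volume A ^ (1 / p) := by
  rw [eLpNorm_indicator_const hA (by simpa using hp) ENNReal.ofReal_ne_top,
    ENNReal.toReal_ofReal hp.le]
  simp

theorem exists_isTest_tendsto_ball (hN : 1 ≤ N) (hs0 : 0 < s) (hs1 : s < 1) (a : E N) {r : ℝ}
    (hr : 0 < r) :
    ∃ φ : ℕ → E N → ℝ, (∀ n, IsTest (φ n)) ∧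
      Tendsto (fun n => gagliardo s (φ n - ind (Metric.ball a r))) atTop (𝓝 0) ∧
      Tendsto (fun n => eLpNorm (φ n - ind (Metric.ball a r)) 1 volume) atTop (𝓝 0) := by
  have hb : MeasurableSet (Metric.ball a r) := Metric.isOpen_ball.measurableSet
  have hp := one_lt_critExp hN hs0 hs1
  refine exists_isTest_tendsto (measurable_const.indicator hb)
    (memLp_one_iff_integrable.1 (memLp_ind hb measure_ball_lt_top.ne 1)) ?_ ?_
  · refine HasCompactSupport.intro (isCompact_closedBall a r) fun x hx => ?_
    exact Set.indicator_of_notMem (fun h => hx (Metric.ball_subset_closedBall h)) _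
  · rw [gagliardo_ball hN hs0 hs1 a hr]
    exact ENNReal.mul_ne_top (ballConst_ne_top hN hs0 hs1)
      (ENNReal.rpow_ne_top_of_nonneg (by positivity) measure_ball_lt_top.ne)

theorem ind_ball_mem_W (hN : 1 ≤ N) (hs0 : 0 < s) (hs1 : s < 1) (a : E N) {r : ℝ}
    (hr : 0 < r) : ind (Metric.ball a r) ∈ W N s := by
  obtain ⟨φ, h1, h2, h3⟩ := exists_isTest_tendsto_ball hN hs0 hs1 a hr
  exact ⟨memLp_ind Metric.isOpen_ball.measurableSet measure_ball_lt_top.ne 1, φ, h1,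
    by simpa using h2.add h3⟩

theorem ind_ball_mem_D (hN : 1 ≤ N) (hs0 : 0 < s) (hs1 : s < 1) (a : E N) {r : ℝ}
    (hr : 0 < r) : ind (Metric.ball a r) ∈ D N s := by
  obtain ⟨φ, h1, h2, -⟩ := exists_isTest_tendsto_ball hN hs0 hs1 a hr
  exact ⟨memLp_ind Metric.isOpen_ball.measurableSet measure_ball_lt_top.ne _, φ, h1, h2⟩

theorem ind_ball_ne_zero (a : E N) {r : ℝ} (hr : 0 < r) :
    ¬ ind (Metric.ball a r) =ᵐ[volume] 0 := by
  intro h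
  have h2 : volume (Metric.ball a r) = 0 := by
    refine measure_mono_null (fun x hx => ?_) (ae_iff.1 h)
    simpa using hx
  exact (Metric.measure_ball_pos volume a hr).ne' h2

/-- The fractional isoperimetric constant is attained by balls. -/
theorem isoConst_eq_ballConst (hN : 1 ≤ N) (hs0 : 0 < s) (hs1 : s < 1) :
    isoConst N s = ballConst N s := by
  have hp := one_lt_critExp hN hs0 hs1
  have hp0 : 0 < critExp N s := by linarith
  refine le_antisymm ?_ ?_
  · refine (iInf₂_le_of_le (ind (Metric.ball (0 : E N) 1))
      (ind_ball_mem_D hN hs0 hs1 0 one_pos) (iInf_le_of_le (ind_ball_ne_zero 0 one_pos) ?_))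
    rw [eLpNorm_ind Metric.isOpen_ball.measurableSet hp0, ballConst]
  · refine le_iInf₂ fun u hu => le_iInf fun h0 => ?_
    have hne : eLpNorm u (ENNReal.ofReal (critExp N s)) volume ≠ 0 := by
      rw [Ne, eLpNorm_eq_zero_iff hu.1.1 (by simpa using hp0)]
      exact h0
    rw [ENNReal.le_div_iff_mul_le (Or.inl hne) (Or.inl hu.1.2.ne)]
    exact ballConst_mul_eLpNorm_le hN hs0 hs1 (Or.inr hu.1)

end Mollify

/-! ### Sobolev constants -/

section Constants

variable {N : ℕ} {s : ℝ}

theorem gagliardo_le_add {u v : E N → ℝ} (hu : Measurable u) (hv : Measurable v) :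
    gagliardo s u ≤ gagliardo s v + gagliardo s (v - u) := by
  rw [gagliardo_eq_lintegral_pair hu, gagliardo_eq_lintegral_pair hv,
    gagliardo_eq_lintegral_pair (hv.sub hu), ← lintegral_add_left (by fun_prop)]
  refine lintegral_mono fun p => ?_
  have : u p.1 - u p.2 = (v p.1 - v p.2) - ((v - u) p.1 - (v - u) p.2) := by
    simp only [Pi.sub_apply]; ring
  rw [this]
  exact enorm_sub_le

/-- Some test function is at finite distance. Finiteness keeps the Sobolev quotients free of the
case of an infinite numerator. -/
theorem gagliardo_ne_top_of_mem_W (hN : 1 ≤ N) (hs0 : 0 < s) (hs1 : s < 1) {u : E N → ℝ}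
    (hu : u ∈ W N s) : gagliardo s u ≠ ⊤ := by
  obtain ⟨hu1, φ, hφ, hlim⟩ := hu
  obtain ⟨n, hn⟩ := (hlim.eventually (gt_mem_nhds (zero_lt_one (α := ℝ≥0∞)))).exists
  have hae := hu1.1.ae_eq_mk
  have hm := hu1.1.stronglyMeasurable_mk.measurable
  have h1 : gagliardo s (φ n - u) = gagliardo s (φ n - hu1.1.mk u) :=
    gagliardo_congr ((ae_eq_refl _).sub hae)
  have h2 : gagliardo s (φ n - u) ≠ ⊤ := (le_self_add.trans_lt hn).ne_top
  rw [gagliardo_congr hae]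
  refine ne_top_of_le_ne_top (ENNReal.add_ne_top.2
    ⟨(hφ n).gagliardo_ne_top hN hs0 hs1, h1 ▸ h2⟩) ?_
  exact gagliardo_le_add hm (hφ n).1.continuous.measurable

/-- Hölder on `Ω` passes from exponent `q` to the critical one at the price of a power of the
volume. -/
theorem sobolevConst_lower (hN : 1 ≤ N) (hs0 : 0 < s) (hs1 : s < 1) {q : ℝ} (hq : 1 ≤ q)
    (hqp : q < critExp N s) {Ω : Set (E N)} (hΩ : IsOpen Ω) (hne : Ω.Nonempty)
    (hb : Bornology.IsBounded Ω) :
    ballConst N s * volume Ω ^ (1 / critExp N s - 1 / q) ≤ sobolevConst s q Ω := by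
  have hq0 : 0 < q := by linarith
  have hp0 : 0 < critExp N s := by linarith
  have hV0 : volume Ω ≠ 0 := (hΩ.measure_pos volume hne).ne'
  have hVt : volume Ω ≠ ⊤ := hb.measure_lt_top.ne
  refine le_iInf₂ fun u hu => le_iInf fun h0 => ?_
  have hX := gagliardo_ne_top_of_mem_W hN hs0 hs1 hu.1
  have hZ : eLpNorm u (ENNReal.ofReal q) (volume.restrict Ω) ≠ 0 := by
    rw [Ne, eLpNorm_eq_zero_iff hu.1.1.1.restrict (by simpa using hq0)]
    intro h
    refine h0 ?_
    rw [EventuallyEq, ae_restrict_iff' hΩ.measurableSet] at h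
    filter_upwards [h, hu.2] with x h1 h2
    by_cases hx : x ∈ Ω
    · exact h1 hx
    · exact h2 hx
  rw [ENNReal.le_div_iff_mul_le (Or.inl hZ) (Or.inr hX)]
  have h1 := eLpNorm_le_eLpNorm_mul_rpow_measure_univ (p := ENNReal.ofReal q)
    (q := ENNReal.ofReal (critExp N s)) (ENNReal.ofReal_le_ofReal hqp.le)
    (hu.1.1.1.restrict (s := Ω))
  rw [Measure.restrict_apply_univ, ENNReal.toReal_ofReal hq0.le, ENNReal.toReal_ofReal hp0.le]
    at h1
  calc ballConst N s * volume Ω ^ (1 / critExp N s - 1 / q) *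
        eLpNorm u (ENNReal.ofReal q) (volume.restrict Ω)
      ≤ ballConst N s * volume Ω ^ (1 / critExp N s - 1 / q) *
        (eLpNorm u (ENNReal.ofReal (critExp N s)) volume *
          volume Ω ^ (1 / q - 1 / critExp N s)) := by
        gcongr
        refine h1.trans ?_
        gcongr
        exact Measure.restrict_le_self
    _ = ballConst N s * eLpNorm u (ENNReal.ofReal (critExp N s)) volume *
        (volume Ω ^ (1 / critExp N s - 1 / q) * volume Ω ^ (1 / q - 1 / critExp N s)) := by ring
    _ = ballConst N s * eLpNorm u (ENNReal.ofReal (critExp N s)) volume := by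
        rw [← ENNReal.rpow_add _ _ hV0 hVt, sub_add_sub_cancel, sub_self, ENNReal.rpow_zero,
          mul_one]
    _ ≤ gagliardo s u := ballConst_mul_eLpNorm_le hN hs0 hs1 (Or.inl hu.1.1)

theorem sobolevConst_le_of_ball_subset (hN : 1 ≤ N) (hs0 : 0 < s) (hs1 : s < 1) {q : ℝ}
    (hq : 1 ≤ q) {Ω : Set (E N)} {a : E N} {r : ℝ} (hr : 0 < r) (hsub : Metric.ball a r ⊆ Ω) :
    sobolevConst s q Ω ≤
      ballConst N s * volume (Metric.ball (0 : E N) r) ^ (1 / critExp N s - 1 / q) := by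
  have hq0 : 0 < q := by linarith
  have hb : MeasurableSet (Metric.ball a r) := Metric.isOpen_ball.measurableSet
  have hV0 : volume (Metric.ball (0 : E N) r) ≠ 0 := (Metric.measure_ball_pos _ _ hr).ne'
  have hVt : volume (Metric.ball (0 : E N) r) ≠ ⊤ := measure_ball_lt_top.ne
  refine iInf₂_le_of_le (ind (Metric.ball a r)) ⟨ind_ball_mem_W hN hs0 hs1 a hr,
    Eventually.of_forall fun x hx => Set.indicator_of_notMem (fun h => hx (hsub h)) _⟩
    (iInf_le_of_le (ind_ball_ne_zero a hr) (le_of_eq ?_))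
  have hnorm : eLpNorm (ind (Metric.ball a r)) (ENNReal.ofReal q) (volume.restrict Ω) =
      volume (Metric.ball (0 : E N) r) ^ (1 / q) := by
    rw [eLpNorm_indicator_const hb (by simpa using hq0) ENNReal.ofReal_ne_top,
      ENNReal.toReal_ofReal hq0.le, Measure.restrict_apply hb, Set.inter_eq_left.2 hsub,
      Measure.addHaar_ball_center]
    simp
  rw [hnorm, gagliardo_ball hN hs0 hs1 a hr, Measure.addHaar_ball_center,
    ENNReal.rpow_sub _ _ hV0 hVt, mul_div_assoc]

/-- Every smaller positive radius is that of a ball inside `Ω`, and the bound is continuous in the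
radius, so the supremum need not be attained. -/
theorem sobolevConst_upper (hN : 1 ≤ N) (hs0 : 0 < s) (hs1 : s < 1) {q : ℝ} (hq : 1 ≤ q)
    {Ω : Set (E N)} (hΩ : IsOpen Ω) (hne : Ω.Nonempty) (hb : Bornology.IsBounded Ω) :
    sobolevConst s q Ω ≤ ballConst N s *
      volume (Metric.ball (0 : E N) (largestRadius Ω)) ^ (1 / critExp N s - 1 / q) := by
  set S : Set ℝ := {R : ℝ | ∃ x ∈ Ω, Metric.ball x R ⊆ Ω} with hS
  have hρ : largestRadius Ω = sSup S := rfl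
  obtain ⟨M, hM⟩ := hb.subset_ball_lt 0 (0 : E N)
  have hbdd : BddAbove S := by
    refine ⟨M, ?_⟩
    rintro R ⟨x, -, hx⟩
    refine radius_le_of_volume_ball_le hN hM.1.le ?_
    rw [← Measure.addHaar_ball_center volume x R]
    exact measure_mono (hx.trans hM.2)
  obtain ⟨x₀, hx₀⟩ := hne
  obtain ⟨r₀, hr₀, hr₀Ω⟩ := Metric.isOpen_iff.1 hΩ x₀ hx₀
  have hr₀S : r₀ ∈ S := ⟨x₀, hx₀, hr₀Ω⟩
  have hρ0 : 0 < largestRadius Ω := hr₀.trans_le (le_csSup hbdd hr₀S)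
  have key : ∀ r, 0 < r → r < largestRadius Ω → sobolevConst s q Ω ≤ ballConst N s *
      (ENNReal.ofReal (r ^ N) * volume (Metric.ball (0 : E N) 1)) ^
        (1 / critExp N s - 1 / q) := by
    intro r hr hrρ
    obtain ⟨R, ⟨x, -, hx⟩, hrR⟩ := exists_lt_of_lt_csSup ⟨r₀, hr₀S⟩ hrρ
    rw [← volume_ball_zero hN hr.le]
    exact sobolevConst_le_of_ball_subset hN hs0 hs1 hq hr
      ((Metric.ball_subset_ball hrR.le).trans hx)
  rw [volume_ball_zero hN hρ0.le]
  have hv1t : volume (Metric.ball (0 : E N) 1) ≠ ⊤ := measure_ball_lt_top.ne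
  have hcont : Tendsto (fun r : ℝ => ballConst N s *
      (ENNReal.ofReal (r ^ N) * volume (Metric.ball (0 : E N) 1)) ^ (1 / critExp N s - 1 / q))
      (𝓝[<] (largestRadius Ω)) (𝓝 (ballConst N s *
      (ENNReal.ofReal (largestRadius Ω ^ N) * volume (Metric.ball (0 : E N) 1)) ^
        (1 / critExp N s - 1 / q))) := by
    refine ENNReal.Tendsto.const_mul ?_ (Or.inr (ballConst_ne_top hN hs0 hs1))
    refine (ENNReal.continuous_rpow_const.tendsto _).comp ?_
    refine ENNReal.Tendsto.mul_const ?_ (Or.inr hv1t)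
    refine ((ENNReal.continuous_ofReal.comp (continuous_pow N)).tendsto _).mono_left ?_
    exact nhdsWithin_le_nhds
  refine ge_of_tendsto hcont ?_
  filter_upwards [Ioo_mem_nhdsLT hρ0] with r hr using key r hr.1 hr.2

/-- The competitor is the indicator of a ball of volume `v`; the bound is real-valued so that `v`
can be optimized or sent to infinity. -/
theorem sobolevConstWhole_le (hN : 1 ≤ N) (hs0 : 0 < s) (hs1 : s < 1) {q : ℝ} (hq : 1 ≤ q)
    {v : ℝ} (hv : 0 < v) :
    sobolevConstWhole N s q ≤
      ENNReal.ofReal (((ballConst N s).toReal * v ^ (1 / critExp N s) + v) / v ^ (1 / q)) := by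
  have hq0 : 0 < q := by linarith
  obtain ⟨r, hr, hvr⟩ := exists_volume_ball_eq (N := N) hN (m := ENNReal.ofReal v)
    (by simpa using hv) ENNReal.ofReal_ne_top
  refine iInf₂_le_of_le (ind (Metric.ball (0 : E N) r)) (ind_ball_mem_W hN hs0 hs1 0 hr)
    (iInf_le_of_le (ind_ball_ne_zero 0 hr) (le_of_eq ?_))
  have h1 := eLpNorm_ind (N := N) (A := Metric.ball 0 r) Metric.isOpen_ball.measurableSet one_pos
  rw [ENNReal.ofReal_one, div_one, ENNReal.rpow_one] at h1
  rw [h1, eLpNorm_ind Metric.isOpen_ball.measurableSet hq0, gagliardo_ball hN hs0 hs1 0 hr, hvr,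
    ENNReal.ofReal_rpow_of_pos hv, ENNReal.ofReal_rpow_of_pos hv,
    ENNReal.ofReal_div_of_pos (by positivity), ENNReal.ofReal_add (by positivity) hv.le,
    ENNReal.ofReal_mul ENNReal.toReal_nonneg, ENNReal.ofReal_toReal (ballConst_ne_top hN hs0 hs1)]

theorem sobolevConstWhole_one (hN : 1 ≤ N) (hs0 : 0 < s) (hs1 : s < 1) :
    sobolevConstWhole N s 1 = 1 := by
  have hp := one_lt_critExp hN hs0 hs1
  refine le_antisymm ?_ ?_
  -- For balls of large volume the perimeter is negligible compared with the volume.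
  · have hlim : Tendsto (fun v : ℝ => ENNReal.ofReal
        ((ballConst N s).toReal * v ^ (-(1 - 1 / critExp N s)) + 1)) atTop (𝓝 1) := by
      have he : 0 < 1 - 1 / critExp N s := by
        rw [sub_pos, div_lt_one (by linarith)]; exact hp
      have h1 := ((tendsto_rpow_neg_atTop he).const_mul (ballConst N s).toReal).add_const 1
      have h2 := (ENNReal.continuous_ofReal.tendsto _).comp h1
      simpa [Function.comp_def] using h2
    refine ge_of_tendsto hlim ?_
    filter_upwards [eventually_gt_atTop 0] with v hv
    refine (sobolevConstWhole_le hN hs0 hs1 le_rfl hv).trans (le_of_eq ?_)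
    rw [div_one, Real.rpow_one, add_div, div_self hv.ne', mul_div_assoc, ← Real.rpow_sub_one hv.ne']
    congr 4
    ring
  · refine le_iInf₂ fun u hu => le_iInf fun h0 => ?_
    have hZ : eLpNorm u 1 volume ≠ 0 := by
      rw [Ne, eLpNorm_eq_zero_iff hu.1.1 one_ne_zero]; exact h0
    rw [ENNReal.ofReal_one, ENNReal.le_div_iff_mul_le (Or.inl hZ) (Or.inl hu.1.2.ne), one_mul]
    exact le_add_self

/-- Interpolation of Lebesgue norms between `L¹` and `L^p`. -/
theorem eLpNorm_le_interpolate {p q θ : ℝ} (hp : 0 < p) (hq : 0 < q) (hθ0 : 0 ≤ θ) (hθ1 : θ ≤ 1)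
    (hθ : 1 / q = (1 - θ) + θ / p) {u : E N → ℝ} (hu : AEStronglyMeasurable u volume) :
    eLpNorm u (ENNReal.ofReal q) volume ≤
      eLpNorm u 1 volume ^ (1 - θ) * eLpNorm u (ENNReal.ofReal p) volume ^ θ := by
  have hsum : q * (1 - θ) + q * θ / p = 1 := by
    have : q * (1 / q) = q * ((1 - θ) + θ / p) := by rw [hθ]
    rw [mul_one_div_cancel hq.ne'] at this
    have h2 : q * ((1 - θ) + θ / p) = q * (1 - θ) + q * θ / p := by ring
    linarith
  have hU : AEMeasurable (fun x => ENNReal.ofReal |u x|) volume := by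
    have := hu.aemeasurable
    fun_prop
  -- Hölder for `|u|` and `|u| ^ p`, with weights that sum to 1 by the relation defining `θ`.
  have h := ENNReal.lintegral_mul_norm_pow_le hU (hU.pow_const p)
    (p := q * (1 - θ)) (q := q * θ / p) (mul_nonneg hq.le (by linarith)) (by positivity) hsum
  have e1 : ∀ x, ENNReal.ofReal |u x| ^ (q * (1 - θ)) *
      (ENNReal.ofReal |u x| ^ p) ^ (q * θ / p) = ENNReal.ofReal |u x| ^ q := by
    intro x
    rw [← ENNReal.rpow_mul, ← ENNReal.rpow_add_of_nonneg _ _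
      (mul_nonneg hq.le (by linarith)) (by positivity)]
    congr 1
    field_simp
    ring
  simp_rw [e1] at h
  rw [eLpNorm_eq_lintegral_abs hq, eLpNorm_eq_lintegral_abs hp, eLpNorm_one_eq_lintegral_enorm]
  simp only [Real.enorm_eq_ofReal_abs]
  refine (ENNReal.rpow_le_rpow h (by positivity)).trans (le_of_eq ?_)
  rw [ENNReal.mul_rpow_of_nonneg _ _ (by positivity), ← ENNReal.rpow_mul, ← ENNReal.rpow_mul,
    ← ENNReal.rpow_mul]
  congr 2
  · field_simp
  · field_simp

/-- The weighted arithmetic-geometric mean inequality with optimal constant. -/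
theorem rpow_mul_rpow_le_add {θ : ℝ} (hθ0 : 0 < θ) (hθ1 : θ < 1) {X Y : ℝ≥0∞} (hX : X ≠ ⊤)
    (hY : Y ≠ ⊤) :
    ENNReal.ofReal ((1 - θ) ^ (-(1 - θ)) * θ ^ (-θ)) * (X ^ θ * Y ^ (1 - θ)) ≤ X + Y := by
  lift X to NNReal using hX
  lift Y to NNReal using hY
  have h1 : 0 < 1 - θ := by linarith
  -- Dividing each term by its own weight makes the arithmetic mean equal to `X + Y`.
  have h := Real.geom_mean_le_arith_mean2_weighted hθ0.le h1.le
    (div_nonneg X.coe_nonneg hθ0.le) (div_nonneg Y.coe_nonneg h1.le) (by ring)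
  rw [Real.div_rpow X.coe_nonneg hθ0.le, Real.div_rpow Y.coe_nonneg h1.le, mul_div_cancel₀ _ hθ0.ne',
    mul_div_cancel₀ _ h1.ne'] at h
  have e : ∀ Z : NNReal, (Z : ℝ≥0∞) = ENNReal.ofReal (Z : ℝ) := fun Z => by simp
  rw [e X, e Y, ENNReal.ofReal_rpow_of_nonneg X.coe_nonneg hθ0.le, ENNReal.ofReal_rpow_of_nonneg Y.coe_nonneg h1.le,
    ← ENNReal.ofReal_mul (by positivity), ← ENNReal.ofReal_mul (by positivity),
    ← ENNReal.ofReal_add X.coe_nonneg Y.coe_nonneg]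
  refine ENNReal.ofReal_le_ofReal (le_trans (le_of_eq ?_) h)
  rw [Real.rpow_neg hθ0.le, Real.rpow_neg h1.le]
  ring

/-- Interpolation bounds the `L^q` norm by a product, Sobolev turns its critical factor into the
seminorm, and the weighted mean inequality bounds the product by the sum. -/
theorem sobolevConstWhole_lower (hN : 1 ≤ N) (hs0 : 0 < s) (hs1 : s < 1) {q θ : ℝ} (hq : 0 < q)
    (hθ0 : 0 < θ) (hθ1 : θ < 1) (hθ : 1 / q = (1 - θ) + θ / critExp N s) :
    ENNReal.ofReal ((1 - θ) ^ (-(1 - θ)) * θ ^ (-θ)) * ballConst N s ^ θ ≤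
      sobolevConstWhole N s q := by
  have hp0 : 0 < critExp N s := zero_lt_one.trans (one_lt_critExp hN hs0 hs1)
  refine le_iInf₂ fun u hu => le_iInf fun h0 => ?_
  have hX := gagliardo_ne_top_of_mem_W hN hs0 hs1 hu
  have hY := hu.1.2.ne
  have hZ : eLpNorm u (ENNReal.ofReal q) volume ≠ 0 := by
    rw [Ne, eLpNorm_eq_zero_iff hu.1.1 (by simpa using hq)]; exact h0
  rw [ENNReal.le_div_iff_mul_le (Or.inl hZ) (Or.inr (ENNReal.add_ne_top.2 ⟨hX, hY⟩))]
  set K := ENNReal.ofReal ((1 - θ) ^ (-(1 - θ)) * θ ^ (-θ))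
  calc K * ballConst N s ^ θ * eLpNorm u (ENNReal.ofReal q) volume
      ≤ K * ballConst N s ^ θ * (eLpNorm u 1 volume ^ (1 - θ) *
          eLpNorm u (ENNReal.ofReal (critExp N s)) volume ^ θ) := by
        gcongr
        exact eLpNorm_le_interpolate hp0 hq hθ0.le hθ1.le hθ hu.1.1
    _ = K * ((ballConst N s * eLpNorm u (ENNReal.ofReal (critExp N s)) volume) ^ θ *
          eLpNorm u 1 volume ^ (1 - θ)) := by
        rw [ENNReal.mul_rpow_of_nonneg _ _ hθ0.le]; ring
    _ ≤ K * (gagliardo s u ^ θ * eLpNorm u 1 volume ^ (1 - θ)) := by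
        gcongr
        exact ballConst_mul_eLpNorm_le hN hs0 hs1 (Or.inl hu.1)
    _ ≤ gagliardo s u + eLpNorm u 1 volume := rpow_mul_rpow_le_add hθ0 hθ1 hX hY

theorem sobolevConstWhole_upper (hN : 1 ≤ N) (hs0 : 0 < s) (hs1 : s < 1) {q θ : ℝ} (hq : 1 ≤ q)
    (hθ0 : 0 < θ) (hθ1 : θ < 1) (hθ : θ = (N / s) * (1 - 1 / q)) :
    sobolevConstWhole N s q ≤
      ENNReal.ofReal ((1 - θ) ^ (-(1 - θ)) * θ ^ (-θ)) * ballConst N s ^ θ := by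
  have hc0 := ballConst_ne_zero (N := N) hN hs0 hs1
  have hct := ballConst_ne_top (N := N) hN hs0 hs1
  set C := (ballConst N s).toReal with hC
  have hC0 : 0 < C := ENNReal.toReal_pos hc0 hct
  have h1 : 0 < 1 - θ := by linarith
  have hN0 : (0 : ℝ) < N := by exact_mod_cast hN
  -- Here `w` is the critical point of the quotient for balls of volume `v`, in the variable `v ^ (s
  -- / N)`; it makes the mean inequality an equality.
  have hw : 0 < C * (1 - θ) / θ := by positivity
  set w := C * (1 - θ) / θ with hwdef
  refine (sobolevConstWhole_le hN hs0 hs1 hq (v := w ^ ((N : ℝ) / s)) (by positivity)).trans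
    (le_of_eq ?_)
  have hcC : ballConst N s = ENNReal.ofReal C := (ENNReal.ofReal_toReal hct).symm
  conv_rhs => rw [hcC, ENNReal.ofReal_rpow_of_pos hC0, ← ENNReal.ofReal_mul (by positivity)]
  congr 1
  rw [critExp_inv, ← Real.rpow_mul hw.le, ← Real.rpow_mul hw.le]
  have ha : w ^ ((N : ℝ) / s * (((N : ℝ) - s) / N)) = w ^ ((N : ℝ) / s) / w := by
    rw [← Real.rpow_sub_one hw.ne']
    congr 1
    field_simp
  have hb : w ^ ((N : ℝ) / s) = w ^ θ * w ^ ((N : ℝ) / s * (1 / q)) := by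
    rw [← Real.rpow_add hw]
    congr 1
    rw [hθ]; ring
  have hwq : 0 < w ^ ((N : ℝ) / s * (1 / q)) := Real.rpow_pos_of_pos hw _
  have hCw : C / w = θ / (1 - θ) := by
    rw [hwdef]; field_simp
  have hnum : C * (w ^ ((N : ℝ) / s) / w) + w ^ ((N : ℝ) / s) =
      w ^ ((N : ℝ) / s) / (1 - θ) := by
    have : C * (w ^ ((N : ℝ) / s) / w) = C / w * w ^ ((N : ℝ) / s) := by ring
    rw [this, hCw]
    field_simp
    ring
  rw [ha, hnum, hb, hwdef, Real.div_rpow (by positivity) hθ0.le, Real.mul_rpow hC0.le h1.le,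
    ← hwdef, Real.rpow_neg hθ0.le, show -(1 - θ) = θ - 1 by ring, Real.rpow_sub_one h1.ne']
  field_simp

end Constants

end

end FracSobolev

/-! ### Assembly of the three statements -/

theorem theorem1p1 (N : ℕ) (hN : 1 ≤ N) (s : ℝ) (hs0 : 0 < s) (hs1 : s < 1) :
    -- (1) two-sided bounds on bounded domains
    (∀ (q : ℝ), 1 ≤ q → q < FracSobolev.critExp N s →
      ∀ (Ω : Set (FracSobolev.E N)), IsOpen Ω → Ω.Nonempty → Bornology.IsBounded Ω →
        FracSobolev.isoConst N s * volume Ω ^ (1 / FracSobolev.critExp N s - 1 / q)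
            ≤ FracSobolev.sobolevConst s q Ω ∧
        FracSobolev.sobolevConst s q Ω
            ≤ FracSobolev.isoConst N s *
              volume (Metric.ball (0 : FracSobolev.E N) (FracSobolev.largestRadius Ω))
                ^ (1 / FracSobolev.critExp N s - 1 / q)) ∧
    -- (2) the whole space, `q = 1`
    FracSobolev.sobolevConstWhole N s 1 = 1 ∧
    -- (3) the whole space, `1 < q < 1_s^*`
    (∀ (q : ℝ), 1 < q → q < FracSobolev.critExp N s →
      ENNReal.ofReal
          (((N / s) * (1 / q - 1 / FracSobolev.critExp N s))
              ^ ((N / s) * (1 / FracSobolev.critExp N s - 1 / q)) *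
            ((N / s) * (1 - 1 / q)) ^ ((N / s) * (1 / q - 1))) *
          FracSobolev.isoConst N s ^ ((N / s) * (1 - 1 / q))
        ≤ FracSobolev.sobolevConstWhole N s q ∧
      FracSobolev.sobolevConstWhole N s q
        ≤ ENNReal.ofReal
            ((s / N) *
              (1 / q - 1 / FracSobolev.critExp N s)
                ^ ((N / s) * (1 / FracSobolev.critExp N s - 1 / q)) *
              (1 - 1 / q) ^ ((N / s) * (1 / q - 1))) *
          FracSobolev.isoConst N s ^ ((N / s) * (1 - 1 / q))) := by
  have hN0 : (0 : ℝ) < N := by exact_mod_cast hN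
  have hp := FracSobolev.one_lt_critExp hN hs0 hs1
  have hpinv : 1 / FracSobolev.critExp N s = ((N : ℝ) - s) / N := FracSobolev.critExp_inv
  rw [FracSobolev.isoConst_eq_ballConst hN hs0 hs1]
  refine ⟨fun q hq hqp Ω hΩ hne hb => ⟨FracSobolev.sobolevConst_lower hN hs0 hs1 hq hqp hΩ hne hb,
    FracSobolev.sobolevConst_upper hN hs0 hs1 hq hΩ hne hb⟩, FracSobolev.sobolevConstWhole_one hN hs0 hs1,
    fun q hq hqp => ?_⟩
  have hq0 : 0 < q := by linarith
  -- This is the interpolation parameter with `1 / q = (1 - θ) + θ / critExp N s`; all exponents in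
  -- the statement are expressed through it.
  set θ : ℝ := (N / s) * (1 - 1 / q) with hθ
  have hA : (N / s) * (1 / q - 1 / FracSobolev.critExp N s) = 1 - θ := by
    rw [hpinv, hθ]; field_simp; ring
  have hA' : 1 / q - 1 / FracSobolev.critExp N s = s / N * (1 - θ) := by
    rw [← hA]; field_simp
  have hB' : 1 - 1 / q = s / N * θ := by rw [hθ]; field_simp
  have e1 : (N / s) * (1 / FracSobolev.critExp N s - 1 / q) = -(1 - θ) := by rw [← hA]; ring
  have e2 : (N / s) * (1 / q - 1) = -θ := by rw [hθ]; ring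
  have hθ0 : 0 < θ := mul_pos (by positivity) (by
    rw [sub_pos, div_lt_one hq0]; exact hq)
  have hθ1 : 0 < 1 - θ := by
    rw [← hA]
    exact mul_pos (by positivity) (sub_pos.2 (one_div_lt_one_div_of_lt hq0 hqp))
  have hθq : 1 / q = (1 - θ) + θ / FracSobolev.critExp N s := by
    have : θ / FracSobolev.critExp N s = θ * (1 / FracSobolev.critExp N s) := by ring
    rw [this, hpinv]
    have h2 : ((N : ℝ) - s) / N = 1 - s / N := by field_simp
    rw [h2]
    linear_combination -hB'
  -- The powers of `s / N` have exponents adding up to -1 and cancel the prefactor, so the upper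
  -- constant equals the lower one.
  have hconst : (s / N) * (1 / q - 1 / FracSobolev.critExp N s) ^ (-(1 - θ)) * (1 - 1 / q) ^ (-θ) =
      (1 - θ) ^ (-(1 - θ)) * θ ^ (-θ) := by
    have hsN : 0 < s / N := by positivity
    rw [hA', hB', Real.mul_rpow hsN.le hθ1.le, Real.mul_rpow hsN.le hθ0.le]
    have h3 : (s / N) * ((s / N) ^ (-(1 - θ)) * (s / N) ^ (-θ)) = 1 := by
      rw [← Real.rpow_add hsN, show -(1 - θ) + -θ = -1 by ring, Real.rpow_neg_one,
        mul_inv_cancel₀ hsN.ne']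
    linear_combination ((1 - θ) ^ (-(1 - θ)) * θ ^ (-θ)) * h3
  rw [e1, e2, hA, hconst]
  exact ⟨FracSobolev.sobolevConstWhole_lower hN hs0 hs1 hq0 hθ0 (by linarith) hθq,
    FracSobolev.sobolevConstWhole_upper hN hs0 hs1 hq.le hθ0 (by linarith) hθ⟩
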